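/- Let $\mathcal C$ be a (not necessarily strict, rigid or semisimple) $C^*$-tensor category, with unitary associators $a_{X,Y,Z}:X\otimes(Y\otimes Z)\to(X\otimes Y)\otimes Z$ and unitary unitors, and with simple tensor unit $\mathbf 1$, i.e. $\operatorname{Hom}(\mathbf 1,\mathbf 1)\cong\mathbb C$. An algebra $A=(X,m,\iota)$ in $\mathcal C$ is an object $X$ with an associative multiplication $m:X\otimes X\to X$ and a monic two-sided unit $\iota:\mathbf 1\to X$. It is *haploid* if $\dim\operatorname{Hom}(\mathbf 1,X)=1$, and *normalized* if $\iota^*\iota=1_{\mathbf 1}$. A haploid algebra is *rigid* if, for the unique $\varepsilon:X\to\mathbf 1$ with $\varepsilon\iota=1_{\mathbf 1}$, the morphism $\varepsilon m:X\otimes X\to\mathbf 1$ is the evaluation of a solution of the conjugate (duality) equations for $X$ and $\overline X=X$. A *Q-system* is an algebra which is special ($mm^*$ is a scalar multiple of $1_X$) and $C^*$-Frobenius, i.e. $(m\otimes 1_X)\,a_{X,X,X}\,(1_X\otimes m^*)=m^*m=(1_X\otimes m)\,a_{X,X,X}^{-1}\,(m^*\otimes 1_X)$. It is *standard* if $e=\iota^*m$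 and $i=m^*\iota$ form a standard solution of the conjugate equations for $X$ and $\overline X=X$, i.e. a solution with $e(1_{\overline X}\otimes T)e^*=i^*(T\otimes 1_{\overline X})i$ for all $T\in\operatorname{Hom}(X,X)$. An *equivalence* from $(X,m,\iota)$ to $(Y,n,j)$ is an isomorphism $S:X\to Y$ with $Sm=n(S\otimes S)$ and $S\iota=j$; it is a *unitary equivalence* if moreover $S$ is unitary. Theorem. (a) Every normalized haploid Q-system in $\mathcal C$ is standard. (b) Every equivalence of algebras between two normalized haploid Q-systems in $\mathcal C$ is unitary. (c) Every normalized haploid Q-system is a rigid haploid algebra, and sending a normalized haploid Q-system to its underlying algebra induces a one-to-one correspondence between unitary equivalence classes of normalized haploid Q-systems in $\mathcal C$ and equivalence classes of rigid haploid algebras in $\mathcal C$. -/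

import Mathlib

open CategoryTheory MonoidalCategory
open scoped MonObj ComplexConjugate

universe v u

/-- A C*-category: a `ℂ`-linear category whose morphism spaces are complex Banach spaces with a
submultiplicative norm, equipped with an antilinear involutive contravariant `*`-operation that is
the identity on objects, satisfying the C*-identity, and such that every `S* S` is positive in the
C*-algebra of endomorphisms of the source of `S`.

Composition is written in diagrammatic order, so `S* S` is `S ≫ dag S`. -/
class CStarCategory (C : Type u) [Category.{v} C] [Preadditive C] [Linear ℂ C] where
  /-- The norm of a morphism. -/
  homNorm (X Y : C) : Norm (X ⟶ Y)
  homNorm_core (X Y : C) : NormedSpace.Core ℂ (X ⟶ Y)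
  complete (X Y : C) :
    @CompleteSpace (X ⟶ Y) (NormedAddCommGroup.ofCore (homNorm_core X Y)).toUniformSpace
  norm_comp_le {X Y Z : C} (f : X ⟶ Y) (g : Y ⟶ Z) :
    (homNorm X Z).norm (f ≫ g) ≤ (homNorm X Y).norm f * (homNorm Y Z).norm g
  /-- The adjoint `S*` of a morphism `S`. -/
  dag {X Y : C} (f : X ⟶ Y) : Y ⟶ X
  dag_dag {X Y : C} (f : X ⟶ Y) : dag (dag f) = f
  dag_id (X : C) : dag (𝟙 X) = 𝟙 X
  dag_comp {X Y Z : C} (f : X ⟶ Y) (g : Y ⟶ Z) : dag (f ≫ g) = dag g ≫ dag f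
  dag_add {X Y : C} (f g : X ⟶ Y) : dag (f + g) = dag f + dag g
  dag_smul {X Y : C} (c : ℂ) (f : X ⟶ Y) : dag (c • f) = conj c • dag f
  norm_comp_dag {X Y : C} (f : X ⟶ Y) :
    (homNorm X X).norm (f ≫ dag f) = (homNorm X Y).norm f ^ 2
  comp_dag_positive {X Y : C} (f : X ⟶ Y) : ∃ t : X ⟶ X, f ≫ dag f = t ≫ dag t

attribute [reducible, instance] CStarCategory.homNorm

/-- A (not necessarily strict) C*-tensor category: a C*-category with a bilinear monoidal structure
for which `(S ⊗ T)* = S* ⊗ T*` and the associators and unitors are unitary. -/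
class CStarTensorCategory (C : Type u) [Category.{v} C] [Preadditive C] [Linear ℂ C]
    [MonoidalCategory C] [MonoidalPreadditive C] [MonoidalLinear ℂ C]
    extends CStarCategory C where
  dag_tensorHom {X₁ Y₁ X₂ Y₂ : C} (f : X₁ ⟶ Y₁) (g : X₂ ⟶ Y₂) :
    dag (f ⊗ₘ g) = dag f ⊗ₘ dag g
  dag_associator_hom (X Y Z : C) : dag (α_ X Y Z).hom = (α_ X Y Z).inv
  dag_leftUnitor_hom (X : C) : dag (λ_ X).hom = (λ_ X).inv
  dag_rightUnitor_hom (X : C) : dag (ρ_ X).hom = (ρ_ X).inv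

namespace CStarTensorCategory

open CStarCategory (dag dag_id dag_comp dag_dag)

section Equivalence

variable {C : Type u} [Category.{v} C] [MonoidalCategory C]

/-- An equivalence between two algebras: an isomorphism intertwining multiplications and units. -/
def IsEquivalence (A B : Mon C) (S : A.X ≅ B.X) : Prop :=
  μ[A.X] ≫ S.hom = (S.hom ⊗ₘ S.hom) ≫ μ[B.X] ∧ η[A.X] ≫ S.hom = η[B.X]

/-- Two algebras are equivalent. -/
def Equivalent (A B : Mon C) : Prop := ∃ S : A.X ≅ B.X, IsEquivalence A B S

theorem Equivalent.refl (A : Mon C) : Equivalent A A :=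
  ⟨Iso.refl _, by simp [IsEquivalence]⟩

theorem IsEquivalence.symm {A B : Mon C} {S : A.X ≅ B.X} (h : IsEquivalence A B S) :
    IsEquivalence B A S.symm := by
  constructor
  · simp only [Iso.symm_hom, Iso.comp_inv_eq, Category.assoc, h.1]
    simp
  · simp [Iso.comp_inv_eq, h.2]

theorem IsEquivalence.trans {A B D : Mon C} {S : A.X ≅ B.X} {T : B.X ≅ D.X}
    (h : IsEquivalence A B S) (k : IsEquivalence B D T) : IsEquivalence A D (S ≪≫ T) := by
  constructor
  · simp only [Iso.trans_hom, ← Category.assoc, h.1]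
    simp only [Category.assoc, k.1]
    simp
  · simp only [Iso.trans_hom, ← Category.assoc, h.2, k.2]

end Equivalence

variable {C : Type u} [Category.{v} C] [Preadditive C] [Linear ℂ C]

/-- A morphism `S` is unitary if `S* S = 1` and `S S* = 1`. -/
def IsUnitary [CStarCategory C] {X Y : C} (S : X ⟶ Y) : Prop :=
  S ≫ dag S = 𝟙 X ∧ dag S ≫ S = 𝟙 Y

theorem IsUnitary.id [CStarCategory C] (X : C) : IsUnitary (𝟙 X) := by
  simp [IsUnitary, dag_id]

theorem IsUnitary.symm [CStarCategory C] {X Y : C} {S : X ≅ Y} (h : IsUnitary S.hom) :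
    IsUnitary S.symm.hom := by
  have e : S.inv = dag S.hom := by rw [← Category.comp_id S.inv, Iso.inv_comp_eq, h.1]
  constructor
  · simp only [Iso.symm_hom, e, dag_dag, h.2]
  · simp only [Iso.symm_hom, e, dag_dag, h.1]

theorem IsUnitary.comp [CStarCategory C] {X Y Z : C} {S : X ⟶ Y} {T : Y ⟶ Z}
    (h : IsUnitary S) (k : IsUnitary T) : IsUnitary (S ≫ T) := by
  constructor
  · rw [dag_comp, Category.assoc, ← Category.assoc T, k.1, Category.id_comp, h.1]
  · rw [dag_comp, Category.assoc, ← Category.assoc (dag S), h.2, Category.id_comp, k.2]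

variable [MonoidalCategory C] [MonoidalPreadditive C] [MonoidalLinear ℂ C]

variable (C) in
/-- The tensor unit is simple: its endomorphism space is one-dimensional. -/
def SimpleUnit : Prop := Module.finrank ℂ (𝟙_ C ⟶ 𝟙_ C) = 1

/-- An algebra `A = (X, m, ι)`, i.e. a monoid object with monic unit, is haploid if
`Hom(1, X)` is one-dimensional. -/
def IsHaploid (A : Mon C) : Prop := Module.finrank ℂ (𝟙_ C ⟶ A.X) = 1

/-- Rigidity of a haploid algebra: with `ε : X ⟶ 1` the (unique) morphism such that `ε ι = 1`,
the morphism `ε m : X ⊗ X ⟶ 1` is the evaluation of a solution of the conjugate equations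
for `X` and `X`. -/
def IsRigid (A : Mon C) : Prop :=
  ∃ ε : A.X ⟶ 𝟙_ C, η[A.X] ≫ ε = 𝟙 (𝟙_ C) ∧
    ∃ p : ExactPairing A.X A.X, p.evaluation' = μ[A.X] ≫ ε

section CStar

variable [CStarTensorCategory C]

/-- Two algebras are unitarily equivalent. -/
def UnitarilyEquivalent (A B : Mon C) : Prop :=
  ∃ S : A.X ≅ B.X, IsEquivalence A B S ∧ IsUnitary S.hom

/-- The unit of the algebra is an isometry. -/
def IsNormalized (A : Mon C) : Prop := η[A.X] ≫ dag η[A.X] = 𝟙 (𝟙_ C)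

/-- `m m*` is a scalar multiple of the identity. -/
def IsSpecial (A : Mon C) : Prop := ∃ c : ℂ, dag μ[A.X] ≫ μ[A.X] = c • 𝟙 A.X

/-- The Frobenius relations
`(m ⊗ 1) a (1 ⊗ m*) = m* m = (1 ⊗ m) a⁻¹ (m* ⊗ 1)`, where `a : X ⊗ (X ⊗ X) ⟶ (X ⊗ X) ⊗ X`. -/
def IsCStarFrobenius (A : Mon C) : Prop :=
  A.X ◁ dag μ[A.X] ≫ (α_ A.X A.X A.X).inv ≫ μ[A.X] ▷ A.X = μ[A.X] ≫ dag μ[A.X] ∧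
  μ[A.X] ≫ dag μ[A.X] = dag μ[A.X] ▷ A.X ≫ (α_ A.X A.X A.X).hom ≫ A.X ◁ μ[A.X]

/-- A Q-system: an algebra that is special and C*-Frobenius. -/
structure IsQSystem (A : Mon C) : Prop where
  mono_unit : Mono η[A.X]
  special : IsSpecial A
  frobenius : IsCStarFrobenius A

/-- A solution `e : X̄ ⊗ X ⟶ 1`, `i : 1 ⟶ X ⊗ X̄` of the conjugate equations is standard if it is
spherical: `e (1 ⊗ T) e* = i* (T ⊗ 1) i` for every endomorphism `T` of `X`. For `T = 1` this is
the normalization `e e* = i* i = d(X) 1`. (This makes sense without assuming direct sums or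
subobjects in `C`.) -/
def IsStandardSolution {X Xbar : C} (p : ExactPairing X Xbar) : Prop :=
  ∀ T : X ⟶ X,
    dag p.evaluation' ≫ (Xbar ◁ T) ≫ p.evaluation' =
      p.coevaluation' ≫ (T ▷ Xbar) ≫ dag p.coevaluation'

/-- An algebra is standard if `e_A = ι* m` and `i_A = m* ι` form a standard solution of the
conjugate equations for `X` and `X`. -/
def IsStandard (A : Mon C) : Prop :=
  ∃ p : ExactPairing A.X A.X,
    p.evaluation' = μ[A.X] ≫ dag η[A.X] ∧ p.coevaluation' = η[A.X] ≫ dag μ[A.X] ∧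
      IsStandardSolution p

end CStar

variable (C) in
/-- Rigid haploid algebras in `C`. -/
structure RigidHaploidAlgebra where
  /-- The underlying monoid object. -/
  alg : Mon C
  mono_unit : Mono η[alg.X]
  haploid : IsHaploid alg
  rigid : IsRigid alg

variable (C) in
/-- Normalized haploid Q-systems in `C`. -/
structure NormalizedHaploidQSystem [CStarTensorCategory C] where
  /-- The underlying monoid object. -/
  alg : Mon C
  isQSystem : IsQSystem alg
  haploid : IsHaploid alg
  normalized : IsNormalized alg

variable (C) in
/-- Equivalence of rigid haploid algebras. -/
def RigidHaploidAlgebra.setoid : Setoid (RigidHaploidAlgebra C) where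
  r A B := Equivalent A.alg B.alg
  iseqv :=
    { refl := fun A => Equivalent.refl A.alg
      symm := fun ⟨S, h⟩ => ⟨S.symm, h.symm⟩
      trans := fun ⟨S, h⟩ ⟨T, k⟩ => ⟨S ≪≫ T, h.trans k⟩ }

variable (C) in
/-- Unitary equivalence of normalized haploid Q-systems. -/
def NormalizedHaploidQSystem.setoid [CStarTensorCategory C] :
    Setoid (NormalizedHaploidQSystem C) where
  r A B := UnitarilyEquivalent A.alg B.alg
  iseqv :=
    { refl := fun A => ⟨Iso.refl _, by simp [IsEquivalence], IsUnitary.id _⟩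
      symm := fun ⟨S, h, h'⟩ => ⟨S.symm, h.symm, h'.symm⟩
      trans := fun ⟨S, h, h'⟩ ⟨T, k, k'⟩ => ⟨S ≪≫ T, h.trans k, h'.comp k'⟩ }

variable (C) in
/-- Equivalence classes of rigid haploid algebras. -/
abbrev RigidHaploidAlgebraClass := Quotient (RigidHaploidAlgebra.setoid C)

variable (C) in
/-- Unitary equivalence classes of normalized haploid Q-systems. -/
abbrev NormalizedHaploidQSystemClass [CStarTensorCategory C] :=
  Quotient (NormalizedHaploidQSystem.setoid C)

end CStarTensorCategory

/-! Composition is written in the usual order in this overview. A left module endomorphism of a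
haploid algebra is determined by its value on the unit, which lies in the line Hom(1, X), so it is a
scalar; the same holds on the right. For a C*-Frobenius algebra, m(T ⊗ 1)m* and m(1 ⊗ T)m* are such
module maps for every T. Sandwiching 1 ⊗ T ⊗ 1 between the threefold product and its adjoint shows
that the two scalars agree, which is standardness. The same argument along an equivalence S makes S
proportional to the adjoint of its inverse, and normalization of the units fixes the factor to 1.
This unitarity is the injectivity in (c); rigidity holds with ε = ι*.

The substance is surjectivity. For a rigid haploid algebra, End(X) is a finite-dimensional
C*-algebra (`finite_end_of_exactPairing`), and Φ(T) = m(1 ⊗ T)m* is a positive map on it. If q ≥ 0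
and Φ(q) ≤ lq, whatever annihilates q also annihilates m(1 ⊗ q); haploidness and nondegeneracy of εm
then leave only q = 0 or q invertible (`mulMap_irreducible`). Perron–Frobenius theory yields an
invertible positive eigenvector, and makes every superharmonic positive element for its eigenvalue
harmonic.

Conjugating the regular action by a root of the eigenvector gives an action n with nn* scalar. Bend
n to a representation π : X → X ⊗ X. The range of π is invariant under the free action; a partial
trace turns the failure of its complement to be invariant into a superharmonic inequality, which
must be an equality. So the range projection commutes with the action, and this is a Frobenius
relation twisted by b = π*π (`twisted_frobenius`). Transport along a root of b, scaled to make the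
unit isometric, removes the twist; speciality then follows from haploidness. -/

namespace CStarTensorCategory

/-! ### Perron–Frobenius theory on a C*-algebra. -/

section PerronFrobenius

variable {A : Type*} [CStarAlgebra A] [PartialOrder A] [StarOrderedRing A]

/-- An invertible positive element dominates a positive multiple of every given element. -/
theorem exists_pos_smul_le_of_isUnit {a b : A} (ha : 0 ≤ a) (hu : IsUnit a) (hb : 0 ≤ b) :
    ∃ r : ℝ, 0 < r ∧ r • b ≤ a := by
  rcases subsingleton_or_nontrivial A with _ | _
  · exact ⟨1, one_pos, (Subsingleton.elim _ _).le⟩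
  have hs : IsStrictlyPositive a := ⟨ha, hu⟩
  obtain ⟨r, hr, hle⟩ := (CFC.exists_pos_algebraMap_le_iff hs.isSelfAdjoint).2
    fun x hx ↦ hs.spectrum_pos hx
  have hb' : b ≤ algebraMap ℝ A ‖b‖ := (IsSelfAdjoint.of_nonneg hb).le_algebraMap_norm_self
  refine ⟨r / (‖b‖ + 1), by positivity, ?_⟩
  calc (r / (‖b‖ + 1)) • b ≤ (r / (‖b‖ + 1)) • algebraMap ℝ A ‖b‖ :=
        smul_le_smul_of_nonneg_left hb' (by positivity)
    _ = (r * ‖b‖ / (‖b‖ + 1)) • (1 : A) := by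
        rw [Algebra.algebraMap_eq_smul_one, smul_smul]; congr 1; ring
    _ ≤ r • (1 : A) := by
        refine smul_le_smul_of_nonneg_right ?_ zero_le_one
        rw [div_le_iff₀ (by positivity)]
        nlinarith [norm_nonneg b]
    _ ≤ a := by rwa [← Algebra.algebraMap_eq_smul_one]

/-- A linear map is irreducible (in the sense of Perron and Frobenius) if its nonzero
superharmonic positive elements are invertible. -/
def IsIrreducibleMap (Φ : A →ₗ[ℂ] A) : Prop :=
  ∀ (q : A) (l : ℝ), 0 ≤ q → Φ q ≤ l • q → q = 0 ∨ IsUnit q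

variable {Φ : A →ₗ[ℂ] A}

/-- With respect to an invertible positive eigenvector of an irreducible positive map, every
superharmonic positive element is harmonic. -/
theorem IsIrreducibleMap.eq_of_le [Nontrivial A] (irr : IsIrreducibleMap Φ) {h : A} (h0 : 0 ≤ h)
    (hu : IsUnit h) {l : ℝ} (hl : Φ h = l • h) {p : A} (hp : 0 ≤ p) (hle : Φ p ≤ l • p) :
    Φ p = l • p := by
  -- Subtract the largest multiple of `h` below `p`. The remainder is again superharmonic, and it
  -- cannot be invertible, since a further multiple of `h` would then fit under it.
  let K : Set ℝ := {s | 0 ≤ s ∧ s • h ≤ p}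
  have hne : h ≠ 0 := hu.ne_zero
  have hnorm : 0 < ‖h‖ := norm_pos_iff.2 hne
  have hK : IsCompact K := by
    refine Metric.isCompact_of_isClosed_isBounded ?_ ?_
    · refine IsClosed.inter isClosed_Ici ?_
      have : {s : ℝ | s • h ≤ p} = (fun s : ℝ => p - s • h) ⁻¹' {a | 0 ≤ a} := by
        ext s; simp
      change IsClosed {s : ℝ | s • h ≤ p}
      rw [this]
      exact CStarAlgebra.isClosed_nonneg.preimage (by fun_prop)
    · refine (Metric.isBounded_Icc 0 (‖p‖ / ‖h‖)).subset ?_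
      rintro s ⟨hs0, hs⟩
      refine ⟨hs0, ?_⟩
      rw [le_div_iff₀ hnorm]
      have := CStarAlgebra.norm_le_norm_of_nonneg_of_le (smul_nonneg hs0 h0) hs
      rwa [norm_smul, Real.norm_of_nonneg hs0] at this
  obtain ⟨s, ⟨hs0, hs⟩, hmax⟩ := hK.exists_isMaxOn ⟨0, le_rfl, by simpa using hp⟩
    (continuous_id.continuousOn)
  have hq : 0 ≤ p - s • h := sub_nonneg.2 hs
  have hΦ : Φ (p - s • h) ≤ l • (p - s • h) := by
    rw [map_sub, LinearMap.map_smul_of_tower, hl, smul_sub, smul_comm s l]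
    exact sub_le_sub_right hle _
  rcases irr _ l hq hΦ with hz | hz
  · have : p = s • h := sub_eq_zero.1 hz
    rw [this, LinearMap.map_smul_of_tower, hl, smul_comm]
  · obtain ⟨r, hr, hrle⟩ := exists_pos_smul_le_of_isUnit hq hz h0
    have hmem : s + r ∈ K := ⟨by positivity, by
      rw [add_smul, add_comm]; exact le_sub_iff_add_le.1 hrle⟩
    have := hmax hmem
    simp only [id, Set.mem_ofPred_eq] at this
    linarith

/-- The resolvent of a positive map at a large scalar. -/
theorem exists_positive_resolvent [FiniteDimensional ℂ A] (hpos : ∀ a, 0 ≤ a → 0 ≤ Φ a) :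
    ∃ (R : A →ₗ[ℂ] A) (r : ℝ), 0 < r ∧ (∀ a, 0 ≤ a → 0 ≤ R a) ∧
      (∀ a, R a - r • Φ (R a) = a) ∧ (∀ a, R (Φ a) = Φ (R a)) := by
  let T : A →L[ℂ] A := LinearMap.toContinuousLinearMap Φ
  have hT : ∀ a, T a = Φ a := fun a => rfl
  -- This choice gives `r • T` norm below one, so the Neumann series converges; its terms preserve
  -- positivity.
  let r : ℝ := (‖T‖ + 1)⁻¹
  have hr : 0 < r := by positivity
  let S : A →L[ℂ] A := (r : ℂ) • T
  have hS : ‖S‖ < 1 := by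
    rw [norm_smul, Complex.norm_real, Real.norm_of_nonneg hr.le]
    rw [inv_mul_lt_iff₀ (by positivity)]
    linarith
  have h1 := geom_series_mul_neg S hS
  have h2 := mul_neg_geom_series S hS
  set G : A →L[ℂ] A := ∑' i : ℕ, S ^ i with hG
  have hSa : ∀ a, S a = r • Φ a := fun a => by
    change (r : ℂ) • T a = _
    rw [hT, Complex.coe_smul]
  have hcomm : ∀ a, G (S a) = S (G a) := fun a => by
    have e : G * S = S * G := by
      have := h1.trans h2.symm
      rw [mul_sub, sub_mul, mul_one, one_mul] at this
      exact sub_right_injective this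
    exact DFunLike.congr_fun e a
  refine ⟨G, r, hr, fun a ha => ?_, fun a => ?_, fun a => ?_⟩
  · have hpow : ∀ i : ℕ, 0 ≤ (S ^ i) a := by
      intro i
      induction i with
      | zero => simpa using ha
      | succ k ih =>
        rw [pow_succ', mul_apply_eq_comp, hSa]
        exact smul_nonneg hr.le (hpos _ ih)
    have hsum : HasSum (fun i : ℕ => (S ^ i) a) (G a) :=
      ((summable_geometric_of_norm_lt_one hS).hasSum).mapL
        (ContinuousLinearMap.apply ℂ A a)
    refine CStarAlgebra.isClosed_nonneg.mem_of_tendsto hsum (Filter.Eventually.of_forall ?_)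
    intro s
    exact Finset.sum_nonneg fun i _ => hpow i
  · have := DFunLike.congr_fun h2 a
    rw [sub_mul, one_mul] at this
    change G a - S (G a) = a at this
    rwa [hSa] at this
  · have := hcomm a
    rw [hSa, hSa] at this
    change G (r • Φ a) = _ at this
    rw [show G (r • Φ a) = r • G (Φ a) from LinearMap.map_smul_of_tower (G : A →ₗ[ℂ] A) r _] at this
    exact smul_right_injective A hr.ne' this

/-- **Perron–Frobenius**: an irreducible positive map on a finite-dimensional C*-algebra has an
invertible positive eigenvector. -/
theorem IsIrreducibleMap.exists_eigenvector [Nontrivial A] [FiniteDimensional ℂ A]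
    (irr : IsIrreducibleMap Φ) (hpos : ∀ a, 0 ≤ a → 0 ≤ Φ a) :
    ∃ (h : A) (l : ℝ), 0 ≤ h ∧ IsUnit h ∧ Φ h = l • h := by
  have : ProperSpace A := FiniteDimensional.proper ℂ A
  let L : ℝ := ‖Φ 1‖
  -- Minimize the scalar among normalized superharmonic positive elements. The bound `L` makes the
  -- set compact, and `(L, 1)` shows that it is nonempty.
  let K : Set (ℝ × A) := {x | x.1 ∈ Set.Icc 0 L ∧ 0 ≤ x.2 ∧ ‖x.2‖ = 1 ∧ Φ x.2 ≤ x.1 • x.2}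
  have hΦc : Continuous Φ := LinearMap.continuous_of_finiteDimensional Φ
  have hK : IsCompact K := by
    refine Metric.isCompact_of_isClosed_isBounded ?_ ?_
    · refine (isClosed_Icc.preimage continuous_fst).inter
        ((CStarAlgebra.isClosed_nonneg.preimage continuous_snd).inter
          ((isClosed_eq (by fun_prop) continuous_const).inter ?_))
      have : {x : ℝ × A | Φ x.2 ≤ x.1 • x.2} =
          (fun x : ℝ × A => x.1 • x.2 - Φ x.2) ⁻¹' {a | 0 ≤ a} := by
        ext s; simp
      change IsClosed {x : ℝ × A | Φ x.2 ≤ x.1 • x.2}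
      rw [this]
      exact CStarAlgebra.isClosed_nonneg.preimage (by fun_prop)
    · refine ((Metric.isBounded_Icc 0 L).prod (Metric.isBounded_closedBall (x := 0) (r := 1))).subset ?_
      rintro x ⟨h1, -, h3, -⟩
      exact ⟨h1, by simp [h3]⟩
  have hKne : K.Nonempty := by
    refine ⟨(L, 1), ⟨norm_nonneg _, le_rfl⟩, zero_le_one, norm_one, ?_⟩
    have := (IsSelfAdjoint.of_nonneg (hpos 1 zero_le_one)).le_algebraMap_norm_self
    rwa [Algebra.algebraMap_eq_smul_one] at this
  obtain ⟨⟨l, h⟩, ⟨⟨hl0, hlL⟩, h0, hn, hle⟩, hmin⟩ := hK.exists_isMinOn hKne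
    continuous_fst.continuousOn
  simp only at hl0 hlL h0 hn hle
  have hne : h ≠ 0 := by rintro rfl; simp at hn
  refine ⟨h, l, h0, (irr h l h0 hle).resolve_left hne, ?_⟩
  by_contra hcon
  -- If the defect `y` were nonzero, the resolvent would make it invertible, because `R y` is
  -- superharmonic. Then `R y` dominates `s • R h` with `s > 0`, so `R h` is superharmonic for the
  -- smaller scalar `l - s`.
  obtain ⟨R, r, hr, hRpos, hR, hRc⟩ := exists_positive_resolvent hpos
  set y := l • h - Φ h with hy
  have hy0 : 0 ≤ y := sub_nonneg.2 hle
  have hyne : y ≠ 0 := fun e => hcon (sub_eq_zero.1 e).symm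
  have hRy : 0 ≤ R y := hRpos y hy0
  have hΦRy : Φ (R y) ≤ r⁻¹ • R y := by
    have : r • Φ (R y) ≤ R y := by
      rw [← sub_nonneg, hR]; exact hy0
    calc Φ (R y) = r⁻¹ • r • Φ (R y) := by rw [smul_smul, inv_mul_cancel₀ hr.ne', one_smul]
      _ ≤ r⁻¹ • R y := smul_le_smul_of_nonneg_left this (by positivity)
  have hunit : IsUnit (R y) := by
    refine (irr _ _ hRy hΦRy).resolve_left fun e => hyne ?_
    rw [← hR y, e]; simp
  have hRh0 : 0 ≤ R h := hRpos h h0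
  have hRhne : R h ≠ 0 := fun e => hne (by rw [← hR h, e]; simp)
  obtain ⟨s, hs, hsle⟩ := exists_pos_smul_le_of_isUnit hRy hunit hRh0
  have key : Φ (R h) ≤ (l - s) • R h := by
    have : R y = l • R h - Φ (R h) := by
      rw [hy, map_sub, LinearMap.map_smul_of_tower, hRc]
    rw [this] at hsle
    rw [sub_smul]
    exact le_sub_comm.1 hsle
  have hnpos : 0 < ‖R h‖ := norm_pos_iff.2 hRhne
  set g := ‖R h‖⁻¹ • R h with hg
  have hg0 : 0 ≤ g := smul_nonneg (by positivity) hRh0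
  have hgn : ‖g‖ = 1 := by
    rw [hg, norm_smul, norm_inv, norm_norm, inv_mul_cancel₀ hnpos.ne']
  have hgle : Φ g ≤ (l - s) • g := by
    rw [hg, LinearMap.map_smul_of_tower, smul_comm]
    exact smul_le_smul_of_nonneg_left key (by positivity)
  -- Membership in `K` also requires a nonnegative scalar; positivity of `Φ` excludes a negative one
  -- for a nonzero positive element.
  have hls : 0 ≤ l - s := by
    by_contra hlt
    push Not at hlt
    have h1 : 0 ≤ (l - s) • g := (hpos g hg0).trans hgle
    have h2 : (l - s) • g ≤ 0 := smul_nonpos_of_nonpos_of_nonneg hlt.le hg0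
    have h3 := le_antisymm h2 h1
    rcases smul_eq_zero.1 h3 with h | h
    · exact hlt.ne h
    · rw [h, norm_zero] at hgn; exact zero_ne_one hgn
  have hmem : ((l - s, g) : ℝ × A) ∈ K := ⟨⟨hls, by simp only; linarith⟩, hg0, hgn, hgle⟩
  have := hmin hmem
  simp only [Set.mem_ofPred_eq] at this
  linarith

end PerronFrobenius

/-- A space with an inner product in which orthonormal families have bounded cardinality is
finite-dimensional. -/
theorem finite_of_orthonormal_bound {V : Type*} [AddCommGroup V] [Module ℂ V]
    (core : InnerProductSpace.Core ℂ V) (K : ℕ)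
    (hK : ∀ (N : ℕ) (v : Fin N → V),
      (∀ i j, core.inner (v i) (v j) = if i = j then 1 else 0) → N ≤ K) :
    Module.Finite ℂ V := by
  let _ : NormedAddCommGroup V := core.toNormedAddCommGroup
  let _ : InnerProductSpace ℂ V := .ofCore core.toCore
  -- The span of a finite linearly independent set has an orthonormal basis of the same cardinality,
  -- so the bound limits the rank.
  have hrank : Module.rank ℂ V ≤ K := by
    refine rank_le fun s hs => ?_
    let W : Submodule ℂ V := Submodule.span ℂ (Set.range fun i : s => (i : V))
    have hW : Module.finrank ℂ W = s.card := by
      rw [finrank_span_eq_card hs]; simp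
    have : FiniteDimensional ℂ W := FiniteDimensional.span_of_finite ℂ (Set.finite_range _)
    let b := stdOrthonormalBasis ℂ W
    rw [← hW]
    refine hK _ (fun i => (b i : V)) fun i j => ?_
    exact orthonormal_iff_ite.1 b.orthonormal i j
  exact Module.rank_lt_aleph0_iff.1 (hrank.trans_lt (Cardinal.natCast_lt_aleph0))

/-- In a finite-dimensional algebra, a right-cancellable element is invertible. -/
theorem isUnit_of_mul_right_cancel {A : Type*} [Ring A] [Algebra ℂ A] [FiniteDimensional ℂ A] (b : A)
    (h : ∀ x : A, x * b = 0 → x = 0) : IsUnit b := by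
  have hinj : Function.Injective (LinearMap.mulRight ℂ b) := by
    rw [← LinearMap.ker_eq_bot, LinearMap.ker_eq_bot']
    exact fun x hx => h x hx
  obtain ⟨c, hc⟩ := LinearMap.injective_iff_surjective.1 hinj 1
  have hc' : c * b = 1 := hc
  have hbc : b * c = 1 := by
    have : (b * c - 1) * b = 0 := by rw [sub_mul, mul_assoc, hc']; simp
    exact sub_eq_zero.1 (h _ this)
  exact ⟨⟨b, c, hbc, hc'⟩, rfl⟩

end CStarTensorCategory

/-! ### Endomorphisms in a C*-category: the C*-algebra structure and positivity. -/

namespace CStarTensorCategory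

open CStarCategory (dag dag_id dag_comp dag_dag dag_add dag_smul norm_comp_le norm_comp_dag
  comp_dag_positive)

/-- A C*-algebra structure from a norm on a complex star algebra. -/
noncomputable abbrev cstarAlgebraOfCore {E : Type*} [R : Ring E] [A : Algebra ℂ E]
    [S : StarRing E] [N : Norm E]
    (core : NormedSpace.Core ℂ E)
    (complete : @CompleteSpace E (NormedAddCommGroup.ofCore core).toUniformSpace)
    (norm_mul : ∀ a b : E, ‖a * b‖ ≤ ‖a‖ * ‖b‖)
    (norm_star_mul : ∀ a : E, ‖a‖ * ‖a‖ ≤ ‖star a * a‖)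
    (star_smul : ∀ (c : ℂ) (a : E), star (c • a) = star c • star a) : CStarAlgebra E :=
  letI G : NormedAddCommGroup E := NormedAddCommGroup.ofCore core
  letI NR : NormedRing E :=
    { R with
      norm := G.norm
      dist := G.dist
      dist_self := G.dist_self
      dist_comm := G.dist_comm
      dist_triangle := G.dist_triangle
      edist := G.edist
      edist_dist := G.edist_dist
      toUniformSpace := G.toUniformSpace
      uniformity_dist := G.uniformity_dist
      toBornology := G.toBornology
      cobounded_sets := G.cobounded_sets
      eq_of_dist_eq_zero := G.eq_of_dist_eq_zero
      dist_eq := G.dist_eq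
      norm_mul_le := norm_mul }
  { NR, S with
    complete := complete.complete
    norm_mul_self_le := norm_star_mul
    toAlgebra := A
    norm_smul_le := fun c a => (core.norm_smul c a).le
    star_smul := star_smul }

theorem isIso_of_comp_right_cancel {C : Type u} [Category.{v} C] [Preadditive C] [Linear ℂ C]
    {X : C} [Module.Finite ℂ (X ⟶ X)] (b : X ⟶ X)
    (h : ∀ x : X ⟶ X, b ≫ x = 0 → x = 0) : IsIso b := by
  have : FiniteDimensional ℂ (End X) := inferInstanceAs (Module.Finite ℂ (X ⟶ X))
  exact (isUnit_iff_isIso b).1 (isUnit_of_mul_right_cancel (End.of b) h)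

variable {C : Type u} [Category.{v} C] [Preadditive C] [Linear ℂ C] [CStarCategory C]

/-- Multiplication in `End X` reverses diagrammatic composition, so `star a * a` is `a ≫ dag a`. -/
instance endStarRing (X : C) : StarRing (End X) where
  star a := End.of (dag a.asHom)
  star_involutive a := dag_dag a.asHom
  star_mul a b := dag_comp b.asHom a.asHom
  star_add a b := dag_add a.asHom b.asHom

instance endNorm (X : C) : Norm (End X) := CStarCategory.homNorm X X

/-- The C*-algebra of endomorphisms of an object of a C*-category. -/
noncomputable abbrev endCStarAlgebra (X : C) : CStarAlgebra (End X) :=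
  cstarAlgebraOfCore (E := End X) (CStarCategory.homNorm_core X X) (CStarCategory.complete X X)
    (fun a b => (norm_comp_le b.asHom a.asHom).trans (mul_comm _ _).le)
    (fun a => by
      have := norm_comp_dag a.asHom
      rw [sq] at this
      exact this.symm.le)
    (fun c a => dag_smul c a.asHom)


theorem dag_zero (X Y : C) : dag (0 : X ⟶ Y) = 0 := by
  simpa using dag_smul (0 : ℂ) (0 : X ⟶ Y)

theorem dag_neg {X Y : C} (f : X ⟶ Y) : dag (-f) = -dag f := by
  simpa using dag_smul (-1 : ℂ) f

theorem dag_sub {X Y : C} (f g : X ⟶ Y) : dag (f - g) = dag f - dag g := by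
  rw [sub_eq_add_neg, dag_add, dag_neg, sub_eq_add_neg]

theorem dag_sum {κ : Type*} {X Y : C} (s : Finset κ) (f : κ → (X ⟶ Y)) :
    dag (∑ i ∈ s, f i) = ∑ i ∈ s, dag (f i) := by
  classical
  induction s using Finset.induction_on with
  | empty => simp [dag_zero]
  | insert a s ha ih => rw [Finset.sum_insert ha, Finset.sum_insert ha, dag_add, ih]

theorem eq_zero_of_homNorm_eq_zero {X Y : C} {f : X ⟶ Y}
    (h : (CStarCategory.homNorm X Y).norm f = 0) : f = 0 :=
  ((CStarCategory.homNorm_core X Y).norm_eq_zero_iff f).1 h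

theorem eq_zero_of_comp_dag {X Y : C} {f : X ⟶ Y} (h : f ≫ dag f = 0) : f = 0 := by
  apply eq_zero_of_homNorm_eq_zero
  have h1 := norm_comp_dag f
  rw [h, ((CStarCategory.homNorm_core X X).norm_eq_zero_iff 0).2 rfl] at h1
  exact pow_eq_zero_iff two_ne_zero |>.1 h1.symm

theorem eq_zero_of_dag_eq_zero {X Y : C} {f : X ⟶ Y} (h : dag f = 0) : f = 0 := by
  rw [← dag_dag f, h, dag_zero]

theorem eq_zero_of_dag_comp {X Y : C} {f : X ⟶ Y} (h : dag f ≫ f = 0) : f = 0 :=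
  eq_zero_of_dag_eq_zero (eq_zero_of_comp_dag (by rwa [dag_dag]))

/-- Positive endomorphisms. -/
def IsPos {X : C} (a : X ⟶ X) : Prop := ∃ t : X ⟶ X, a = t ≫ dag t

theorem isPos_comp_dag {X Y : C} (f : X ⟶ Y) : IsPos (f ≫ dag f) := comp_dag_positive f

theorem isPos_dag_comp {X Y : C} (f : X ⟶ Y) : IsPos (dag f ≫ f) := by
  have := isPos_comp_dag (dag f)
  rwa [dag_dag] at this

theorem isPos_zero (X : C) : IsPos (0 : X ⟶ X) := ⟨0, by simp⟩

theorem isPos_id (X : C) : IsPos (𝟙 X) := ⟨𝟙 X, by simp [dag_id]⟩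

theorem IsPos.dag_eq {X : C} {a : X ⟶ X} (h : IsPos a) : dag a = a := by
  obtain ⟨t, rfl⟩ := h
  rw [dag_comp, dag_dag]

theorem IsPos.conj {X Y : C} {a : X ⟶ X} (h : IsPos a) (f : X ⟶ Y) : IsPos (dag f ≫ a ≫ f) := by
  obtain ⟨t, rfl⟩ := h
  convert isPos_dag_comp (dag t ≫ f) using 1
  simp [dag_comp, dag_dag]

theorem IsPos.conj' {X Y : C} {a : X ⟶ X} (h : IsPos a) (f : Y ⟶ X) : IsPos (f ≫ a ≫ dag f) := by
  have := h.conj (dag f)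
  rwa [dag_dag] at this

/-- The order of the C*-algebra of endomorphisms. -/
@[reducible] noncomputable def endPartialOrder (X : C) : PartialOrder (End X) :=
  @CStarAlgebra.spectralOrder _ (endCStarAlgebra X).toNonUnitalCStarAlgebra

theorem endStarOrderedRing (X : C) :
    @StarOrderedRing (End X) (inferInstance : Ring (End X)).toNonUnitalRing.toNonUnitalSemiring
      (endPartialOrder X) (endStarRing X) :=
  @CStarAlgebra.spectralOrderedRing _ (endCStarAlgebra X).toNonUnitalCStarAlgebra

theorem end_nonneg_iff {X : C} (a : End X) :
    letI := endPartialOrder X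
    0 ≤ a ↔ IsPos a.asHom := by
  let _ := endCStarAlgebra X
  let _ := endPartialOrder X
  have : StarOrderedRing (End X) := endStarOrderedRing X
  exact CStarAlgebra.nonneg_iff_eq_star_mul_self

theorem end_le_iff {X : C} (a b : End X) :
    letI := endPartialOrder X
    a ≤ b ↔ IsPos (b.asHom - a.asHom) := by
  let _ := endCStarAlgebra X
  let _ := endPartialOrder X
  have : StarOrderedRing (End X) := endStarOrderedRing X
  have := end_nonneg_iff (b - a)
  rw [sub_nonneg] at this
  exact this

theorem IsPos.add {X : C} {a b : X ⟶ X} (ha : IsPos a) (hb : IsPos b) : IsPos (a + b) := by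
  let _ := endCStarAlgebra X
  let _ := endPartialOrder X
  have : StarOrderedRing (End X) := endStarOrderedRing X
  have h : 0 ≤ End.of a + End.of b :=
    add_nonneg ((end_nonneg_iff (End.of a)).2 ha) ((end_nonneg_iff (End.of b)).2 hb)
  exact (end_nonneg_iff _).1 h

theorem IsPos.sum {κ : Type*} {X : C} (s : Finset κ) {f : κ → (X ⟶ X)} (h : ∀ i, IsPos (f i)) :
    IsPos (∑ i ∈ s, f i) := by
  classical
  induction s using Finset.induction_on with
  | empty => simpa using isPos_zero X
  | insert a s ha ih => rw [Finset.sum_insert ha]; exact (h a).add ih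

theorem IsPos.eq_zero {X : C} {a : X ⟶ X} (ha : IsPos a) (hb : IsPos (-a)) : a = 0 := by
  let _ := endCStarAlgebra X
  let _ := endPartialOrder X
  have : StarOrderedRing (End X) := endStarOrderedRing X
  have h0 : 0 ≤ End.of a := (end_nonneg_iff (End.of a)).2 ha
  have h1 : 0 ≤ -End.of a := (end_nonneg_iff _).2 hb
  exact le_antisymm (α := End X) (neg_nonneg.1 h1) h0

theorem isPos_norm_smul_sub {X : C} {a : X ⟶ X} (ha : dag a = a) :
    IsPos (((CStarCategory.homNorm X X).norm a : ℂ) • 𝟙 X - a) := by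
  let _ := endCStarAlgebra X
  let _ := endPartialOrder X
  have : StarOrderedRing (End X) := endStarOrderedRing X
  have hs : IsSelfAdjoint (End.of a) := ha
  have h := hs.le_algebraMap_norm_self
  exact (end_le_iff _ _).1 h

theorem norm_le_of_isPos_sub {X : C} {a : X ⟶ X} (ha : IsPos a) {r : ℝ} (hr : 0 ≤ r)
    (h : IsPos ((r : ℂ) • 𝟙 X - a)) : (CStarCategory.homNorm X X).norm a ≤ r := by
  let _ := endCStarAlgebra X
  let _ := endPartialOrder X
  have : StarOrderedRing (End X) := endStarOrderedRing X
  exact (CStarAlgebra.norm_le_iff_le_algebraMap (End.of a) hr ((end_nonneg_iff _).2 ha)).2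
    ((end_le_iff _ (algebraMap ℝ (End X) r)).2 h)

/-- Perron–Frobenius for the endomorphism algebra of an object. -/
theorem exists_positive_eigenvector {X : C} [Module.Finite ℂ (X ⟶ X)] (hX : 𝟙 X ≠ 0)
    (Φ : (X ⟶ X) →ₗ[ℂ] (X ⟶ X)) (hpos : ∀ a, IsPos a → IsPos (Φ a))
    (irr : ∀ (q : X ⟶ X) (l : ℝ), IsPos q → IsPos ((l : ℂ) • q - Φ q) → q = 0 ∨ IsIso q) :
    ∃ (t : X ⟶ X) (l : ℝ), IsIso t ∧ Φ (dag t ≫ t) = (l : ℂ) • (dag t ≫ t) ∧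
      ∀ p, IsPos p → IsPos ((l : ℂ) • p - Φ p) → Φ p = (l : ℂ) • p := by
  let _ := endCStarAlgebra X
  let _ := endPartialOrder X
  have : StarOrderedRing (End X) := endStarOrderedRing X
  have : Nontrivial (End X) := ⟨⟨𝟙 X, 0, hX⟩⟩
  have : FiniteDimensional ℂ (End X) := inferInstanceAs (Module.Finite ℂ (X ⟶ X))
  let Ψ : End X →ₗ[ℂ] End X := Φ
  have hp : ∀ a : End X, 0 ≤ a → 0 ≤ Ψ a := fun a ha =>
    (end_nonneg_iff _).2 (hpos _ ((end_nonneg_iff _).1 ha))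
  have hirr : IsIrreducibleMap Ψ := by
    intro q l h0 hle
    rcases irr q.asHom l ((end_nonneg_iff _).1 h0) ((end_le_iff _ _).1 hle) with h | h
    · exact Or.inl h
    · exact Or.inr ((isUnit_iff_isIso q.asHom).2 h)
  obtain ⟨h, l, h0, hu, hl⟩ := hirr.exists_eigenvector hp
  obtain ⟨s, hs⟩ := (end_nonneg_iff _).1 h0
  have hiso : IsIso (s ≫ dag s) := by
    rw [← hs]; exact (isUnit_iff_isIso h.asHom).1 hu
  have hu' : IsUnit (End.of (dag s)) := by
    refine isUnit_of_mul_right_cancel _ fun x hx => ?_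
    have hx' : dag s ≫ x.asHom = 0 := hx
    have : (s ≫ dag s) ≫ x.asHom = (s ≫ dag s) ≫ 0 := by simp [hx']
    exact (cancel_epi (s ≫ dag s)).1 this
  refine ⟨dag s, l, (isUnit_iff_isIso (dag s)).1 hu', ?_, fun p hp0 hple => ?_⟩
  · rw [dag_dag, ← hs]; exact hl
  · exact hirr.eq_of_le h0 hu hl ((end_nonneg_iff (End.of p)).2 hp0)
      ((end_le_iff (Ψ (End.of p)) _).2 hple)

end CStarTensorCategory

/-! ### Duality, partial traces and finite-dimensionality. -/

namespace CStarTensorCategory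

open CStarCategory (dag dag_id dag_comp dag_dag dag_add dag_smul norm_comp_le norm_comp_dag
  comp_dag_positive)

theorem sub_whiskerRight {C : Type u} [Category.{v} C] [Preadditive C] [MonoidalCategory C]
    [MonoidalPreadditive C] {Y Z : C} (f g : Y ⟶ Z) (X : C) : (f - g) ▷ X = f ▷ X - g ▷ X := by
  rw [eq_sub_iff_add_eq, ← MonoidalPreadditive.add_whiskerRight, sub_add_cancel]

theorem whiskerLeft_sub {C : Type u} [Category.{v} C] [Preadditive C] [MonoidalCategory C]
    [MonoidalPreadditive C] {Y Z : C} (X : C) (f g : Y ⟶ Z) : X ◁ (f - g) = X ◁ f - X ◁ g := by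
  rw [eq_sub_iff_add_eq, ← MonoidalPreadditive.whiskerLeft_add, sub_add_cancel]

section Bend

variable {C : Type u} [Category.{v} C] [MonoidalCategory C] {X Y : C} [ExactPairing X Y]

/-- The vector of `X ⊗ Y` associated to an endomorphism of `X`. -/
def bend (T : X ⟶ X) : 𝟙_ C ⟶ X ⊗ Y := η_ X Y ≫ T ▷ Y

theorem tensorRightHomEquiv_symm_bend (T : X ⟶ X) :
    (tensorRightHomEquiv (𝟙_ C) X Y X).symm (bend T) = (λ_ X).hom ≫ T := by
  change bend T ▷ X ≫ (α_ _ _ _).hom ≫ _ ◁ ε_ X Y ≫ (ρ_ _).hom = _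
  calc _ = (η_ X Y ▷ X ≫ (α_ X Y X).hom) ≫ (T ▷ (Y ⊗ X) ≫ X ◁ ε_ X Y) ≫ (ρ_ X).hom := by
        simp [bend]
    _ = (η_ X Y ▷ X ≫ (α_ X Y X).hom ≫ X ◁ ε_ X Y) ≫ T ▷ 𝟙_ C ≫ (ρ_ X).hom := by
        rw [← whisker_exchange]; simp
    _ = _ := by rw [ExactPairing.evaluation_coevaluation]; simp

end Bend

section Unit

variable {C : Type u} [Category.{v} C] [Preadditive C] [Linear ℂ C] [MonoidalCategory C]

theorem id_unit_ne_zero (hC : SimpleUnit C) : 𝟙 (𝟙_ C) ≠ 0 := by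
  intro h
  have hs : Subsingleton (𝟙_ C ⟶ 𝟙_ C) := ⟨fun a b => by
    rw [← Category.comp_id a, ← Category.comp_id b, h]; simp⟩
  have := Module.finrank_zero_of_subsingleton (R := ℂ) (M := 𝟙_ C ⟶ 𝟙_ C)
  rw [SimpleUnit] at hC
  omega

theorem exists_unit_scalar (hC : SimpleUnit C) (f : 𝟙_ C ⟶ 𝟙_ C) : ∃ c : ℂ, f = c • 𝟙 (𝟙_ C) := by
  obtain ⟨c, hc⟩ := (finrank_eq_one_iff_of_nonzero' (𝟙 (𝟙_ C)) (id_unit_ne_zero hC)).1 hC f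
  exact ⟨c, hc.symm⟩

theorem smul_id_unit_injective (hC : SimpleUnit C) {a b : ℂ}
    (h : a • 𝟙 (𝟙_ C) = b • 𝟙 (𝟙_ C)) : a = b :=
  smul_left_injective ℂ (id_unit_ne_zero hC) h

/-- The identification of the endomorphisms of a simple tensor unit with the complex numbers. -/
noncomputable def unitScalar (hC : SimpleUnit C) : (𝟙_ C ⟶ 𝟙_ C) →ₗ[ℂ] ℂ where
  toFun f := (exists_unit_scalar hC f).choose
  map_add' f g := by
    apply smul_id_unit_injective hC
    rw [← (exists_unit_scalar hC (f + g)).choose_spec, add_smul,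
      ← (exists_unit_scalar hC f).choose_spec, ← (exists_unit_scalar hC g).choose_spec]
  map_smul' c f := by
    apply smul_id_unit_injective hC
    rw [← (exists_unit_scalar hC (c • f)).choose_spec, RingHom.id_apply, smul_eq_mul, mul_smul,
      ← (exists_unit_scalar hC f).choose_spec]

theorem unitScalar_spec (hC : SimpleUnit C) (f : 𝟙_ C ⟶ 𝟙_ C) :
    f = unitScalar hC f • 𝟙 (𝟙_ C) :=
  (exists_unit_scalar hC f).choose_spec

theorem unitScalar_comp (hC : SimpleUnit C) (f g : 𝟙_ C ⟶ 𝟙_ C) :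
    unitScalar hC (f ≫ g) = unitScalar hC f * unitScalar hC g := by
  apply smul_id_unit_injective hC
  rw [← unitScalar_spec]
  conv_lhs => rw [unitScalar_spec hC f, unitScalar_spec hC g]
  simp [smul_smul, mul_comm]

end Unit

variable {C : Type u} [Category.{v} C] [Preadditive C] [Linear ℂ C]
  [MonoidalCategory C] [MonoidalPreadditive C] [MonoidalLinear ℂ C] [CStarTensorCategory C]

theorem dag_whiskerLeft (X : C) {Y Z : C} (f : Y ⟶ Z) : dag (X ◁ f) = X ◁ dag f := by
  rw [← id_tensorHom, dag_tensorHom, dag_id, id_tensorHom]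

theorem dag_whiskerRight {Y Z : C} (f : Y ⟶ Z) (X : C) : dag (f ▷ X) = dag f ▷ X := by
  rw [← tensorHom_id, dag_tensorHom, dag_id, tensorHom_id]

theorem dag_associator_inv (X Y Z : C) : dag (α_ X Y Z).inv = (α_ X Y Z).hom := by
  rw [← dag_associator_hom, dag_dag]

theorem dag_leftUnitor_inv (X : C) : dag (λ_ X).inv = (λ_ X).hom := by
  rw [← dag_leftUnitor_hom, dag_dag]

theorem unitScalar_dag (hC : SimpleUnit C) (f : 𝟙_ C ⟶ 𝟙_ C) :
    unitScalar hC (dag f) = conj (unitScalar hC f) := by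
  apply smul_id_unit_injective hC
  rw [← unitScalar_spec]
  conv_lhs => rw [unitScalar_spec hC f]
  rw [dag_smul, dag_id]

theorem unitScalar_pos (hC : SimpleUnit C) {f : 𝟙_ C ⟶ 𝟙_ C} (hf : IsPos f) :
    ∃ r : ℝ, 0 ≤ r ∧ unitScalar hC f = r := by
  obtain ⟨t, rfl⟩ := hf
  refine ⟨Complex.normSq (unitScalar hC t), Complex.normSq_nonneg _, ?_⟩
  rw [unitScalar_comp, unitScalar_dag, Complex.mul_conj]

section Trace

variable {X Y : C} [ExactPairing X Y]

/-- The partial trace over the second factor. -/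
noncomputable def partialTrace (Z : C) (a : Z ⊗ Y ⟶ Z ⊗ Y) : Z ⟶ Z :=
  (ρ_ Z).inv ≫ Z ◁ dag (ε_ X Y) ≫ (α_ Z Y X).inv ≫ a ▷ X ≫ (α_ Z Y X).hom ≫ Z ◁ ε_ X Y ≫ (ρ_ Z).hom

/-- Bending absorbs the evaluation on each side into `f` and its adjoint. Hence the partial trace is
positive, and it vanishes on `dag f ≫ f` only if `f = 0`. -/
theorem partialTrace_dag_comp {Z W : C} (f : W ⟶ Z ⊗ Y) :
    partialTrace (X := X) Z (dag f ≫ f) =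
      dag ((tensorRightHomEquiv W X Y Z).symm f) ≫ (tensorRightHomEquiv W X Y Z).symm f := by
  change _ = dag (f ▷ X ≫ (α_ _ _ _).hom ≫ _ ◁ ε_ X Y ≫ (ρ_ _).hom) ≫
    f ▷ X ≫ (α_ _ _ _).hom ≫ _ ◁ ε_ X Y ≫ (ρ_ _).hom
  simp [partialTrace, dag_comp, dag_whiskerLeft, dag_whiskerRight, dag_associator_hom,
    dag_rightUnitor_hom]

variable (X) in
theorem partialTrace_sub {Z : C} (a b : Z ⊗ Y ⟶ Z ⊗ Y) :
    partialTrace (X := X) Z (a - b) = partialTrace (X := X) Z a - partialTrace (X := X) Z b := by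
  simp [partialTrace, sub_whiskerRight]

variable (X) in
theorem partialTrace_smul {Z : C} (c : ℂ) (a : Z ⊗ Y ⟶ Z ⊗ Y) :
    partialTrace (X := X) Z (c • a) = c • partialTrace (X := X) Z a := by
  simp [partialTrace, MonoidalLinear.smul_whiskerRight]

variable (X) in
theorem partialTrace_sum {κ : Type*} (s : Finset κ) {Z : C} (a : κ → (Z ⊗ Y ⟶ Z ⊗ Y)) :
    partialTrace (X := X) Z (∑ i ∈ s, a i) = ∑ i ∈ s, partialTrace (X := X) Z (a i) := by
  simp [partialTrace, sum_whiskerRight, Preadditive.sum_comp, Preadditive.comp_sum]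

variable (X) in
theorem IsPos.partialTrace {Z : C} {a : Z ⊗ Y ⟶ Z ⊗ Y} (ha : IsPos a) :
    IsPos (partialTrace (X := X) Z a) := by
  obtain ⟨t, rfl⟩ := ha
  have := partialTrace_dag_comp (X := X) (dag t)
  rw [dag_dag] at this
  rw [this]
  exact isPos_dag_comp _

theorem partialTrace_id (hC : SimpleUnit C) (Z : C) :
    partialTrace (X := X) Z (𝟙 (Z ⊗ Y)) = unitScalar hC (dag (ε_ X Y) ≫ ε_ X Y) • 𝟙 Z := by
  have : partialTrace (X := X) Z (𝟙 (Z ⊗ Y)) =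
      (ρ_ Z).inv ≫ Z ◁ (dag (ε_ X Y) ≫ ε_ X Y) ≫ (ρ_ Z).hom := by
    simp [partialTrace]
  rw [this]
  conv_lhs => rw [unitScalar_spec hC (dag (ε_ X Y) ≫ ε_ X Y)]
  simp [MonoidalLinear.whiskerLeft_smul]

/-- The order matters: inner products of bent vectors involve `T ≫ dag T`, whereas this partial
trace gives `dag T ≫ T`. -/
theorem partialTrace_bend (T : X ⟶ X) :
    partialTrace (X := X) X (dag (bend (Y := Y) T) ≫ bend T) = dag T ≫ T := by
  rw [partialTrace_dag_comp, tensorRightHomEquiv_symm_bend, dag_comp, dag_leftUnitor_hom]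
  simp

variable (Y) in
/-- The trace associated to the coevaluation. -/
noncomputable def coevTrace (hC : SimpleUnit C) : (X ⟶ X) →ₗ[ℂ] ℂ where
  toFun T := unitScalar hC (η_ X Y ≫ T ▷ Y ≫ dag (η_ X Y))
  map_add' S T := by
    simp [MonoidalPreadditive.add_whiskerRight]
  map_smul' c T := by
    simp [MonoidalLinear.smul_whiskerRight]

theorem unitScalar_bend (hC : SimpleUnit C) (S T : X ⟶ X) :
    unitScalar hC (bend (Y := Y) S ≫ dag (bend T)) = coevTrace Y hC (S ≫ dag T) := by
  simp [coevTrace, bend, dag_comp, dag_whiskerRight]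

theorem coevTrace_pos (hC : SimpleUnit C) {T : X ⟶ X} (h : IsPos T) :
    ∃ r : ℝ, 0 ≤ r ∧ coevTrace Y hC T = r := by
  obtain ⟨t, rfl⟩ := h
  rw [← unitScalar_bend]
  exact unitScalar_pos hC (isPos_comp_dag _)

theorem coevTrace_dag (hC : SimpleUnit C) (T : X ⟶ X) :
    coevTrace Y hC (dag T) = conj (coevTrace Y hC T) := by
  rw [coevTrace, LinearMap.coe_mk, AddHom.coe_mk, ← unitScalar_dag]
  simp [dag_comp, dag_whiskerRight, dag_dag]

theorem eq_zero_of_coevTrace_eq_zero (hC : SimpleUnit C) {T : X ⟶ X}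
    (h : coevTrace Y hC (T ≫ dag T) = 0) : T = 0 := by
  rw [← unitScalar_bend] at h
  have h0 : bend (Y := Y) T ≫ dag (bend T) = 0 := by
    rw [unitScalar_spec hC (bend (Y := Y) T ≫ dag (bend T)), h, zero_smul]
  have h1 := tensorRightHomEquiv_symm_bend (Y := Y) T
  rw [eq_zero_of_comp_dag h0] at h1
  have h2 : (tensorRightHomEquiv (𝟙_ C) X Y X).symm 0 = 0 := by
    change (0 : _ ⟶ _) ▷ X ≫ (α_ _ _ _).hom ≫ _ ◁ ε_ X Y ≫ (ρ_ _).hom = 0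
    simp [MonoidalPreadditive.zero_whiskerRight]
  rw [h2] at h1
  rw [← cancel_epi (λ_ X).hom, ← h1]; simp

/-- A Pimsner–Popa type inequality. -/
theorem exists_le_coevTrace (hC : SimpleUnit C) : ∃ K : ℝ, 0 ≤ K ∧ ∀ T : X ⟶ X,
    IsPos (((K * (coevTrace Y hC (T ≫ dag T)).re : ℝ) : ℂ) • 𝟙 X - T ≫ dag T) := by
  -- Unbending factors `T` as `g ≫ w` with `w` independent of `T`, and `g ≫ dag g` is the trace of
  -- `T ≫ dag T`. So `K`, the norm of `w ≫ dag w`, serves for all `T`.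
  let w : (X ⊗ Y) ⊗ X ⟶ X := (α_ _ _ _).hom ≫ _ ◁ ε_ X Y ≫ (ρ_ _).hom
  let K := (CStarCategory.homNorm _ _).norm (w ≫ dag w)
  refine ⟨K, by rw [show K = _ from norm_comp_dag w]; positivity, fun T => ?_⟩
  have hT : T = ((λ_ X).inv ≫ bend (Y := Y) T ▷ X) ≫ w := by
    have := tensorRightHomEquiv_symm_bend (Y := Y) T
    change bend T ▷ X ≫ w = _ at this
    rw [Category.assoc, this]; simp
  set g := (λ_ X).inv ≫ bend (Y := Y) T ▷ X with hg
  have hw := (isPos_norm_smul_sub (a := w ≫ dag w) (by rw [dag_comp, dag_dag])).conj' g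
  convert hw using 1
  have h1 : g ≫ dag g = ((coevTrace Y hC (T ≫ dag T)).re : ℂ) • 𝟙 X := by
    obtain ⟨r, -, hr⟩ := coevTrace_pos (Y := Y) hC (isPos_comp_dag T)
    have h2 : bend (Y := Y) T ≫ dag (bend T) = (r : ℂ) • 𝟙 (𝟙_ C) := by
      rw [unitScalar_spec hC (bend (Y := Y) T ≫ dag (bend T)), unitScalar_bend, hr]
    rw [hr, Complex.ofReal_re, hg, dag_comp, dag_whiskerRight, dag_leftUnitor_inv]
    simp only [Category.assoc]
    rw [← comp_whiskerRight_assoc, h2, MonoidalLinear.smul_whiskerRight, Linear.smul_comp,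
      Linear.comp_smul]
    simp
  rw [Preadditive.sub_comp, Preadditive.comp_sub]
  congr 1
  · simp only [Linear.smul_comp, Linear.comp_smul, Category.id_comp]
    rw [h1, smul_smul]
    push_cast; rfl
  · conv_lhs => rw [hT]
    simp [dag_comp]

/-- An object with a dual has a finite-dimensional endomorphism algebra. -/
theorem finite_end_of_exactPairing (X Y : C) [ExactPairing X Y] (hC : SimpleUnit C) :
    Module.Finite ℂ (X ⟶ X) := by
  obtain ⟨K, hK0, hK⟩ := exists_le_coevTrace (X := X) (Y := Y) hC
  obtain ⟨d, hd0, hd⟩ := unitScalar_pos hC (isPos_dag_comp (ε_ X Y))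
  obtain ⟨d', hd'0, hd'⟩ := coevTrace_pos (Y := Y) hC (isPos_id X)
  let core : InnerProductSpace.Core ℂ (X ⟶ X) :=
    { inner := fun S T => coevTrace Y hC (T ≫ dag S)
      conj_inner_symm := fun S T => by
        rw [← coevTrace_dag, dag_comp, dag_dag]
      re_inner_nonneg := fun S => by
        obtain ⟨r, hr, e⟩ := coevTrace_pos (Y := Y) hC (isPos_comp_dag S)
        rw [e]; simpa using hr
      add_left := fun S T U => by rw [dag_add, Preadditive.comp_add, map_add]
      smul_left := fun S T c => by rw [dag_smul, Linear.comp_smul, map_smul, smul_eq_mul]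
      definite := fun S h => eq_zero_of_coevTrace_eq_zero hC h }
  refine finite_of_orthonormal_bound core ⌈d' * (K * (d * d'))⌉₊ fun N T hT => ?_
  have hT' : ∀ i j, coevTrace Y hC (T j ≫ dag (T i)) = if i = j then 1 else 0 := hT
  have hv : ∀ i j, bend (Y := Y) (T j) ≫ dag (bend (T i)) =
      (if i = j then 1 else 0 : ℂ) • 𝟙 (𝟙_ C) := fun i j => by
    rw [unitScalar_spec hC (bend (Y := Y) (T j) ≫ dag (bend (T i))), unitScalar_bend, hT']
  -- the sum of the range projections is at most one
  set Q : X ⊗ Y ⟶ X ⊗ Y := ∑ i, dag (bend (T i)) ≫ bend (T i) with hQ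
  have hQd : dag Q = Q := by
    rw [hQ, dag_sum]; simp [dag_comp, dag_dag]
  have hQQ : Q ≫ Q = Q := by
    rw [hQ, Preadditive.sum_comp]
    refine Finset.sum_congr rfl fun i _ => ?_
    rw [Preadditive.comp_sum, Finset.sum_eq_single i]
    · rw [Category.assoc, ← Category.assoc (bend (T i)), hv]; simp
    · intro j _ hj
      rw [Category.assoc, ← Category.assoc (bend (T i)), hv, if_neg hj]; simp
    · simp
  have hpos : IsPos (𝟙 _ - Q) := by
    have := isPos_comp_dag (𝟙 _ - Q)
    have e : (𝟙 (X ⊗ Y) - Q) ≫ dag (𝟙 (X ⊗ Y) - Q) = 𝟙 (X ⊗ Y) - Q := by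
      rw [dag_sub, dag_id, hQd]
      simp [Preadditive.sub_comp, Preadditive.comp_sub, hQQ]
    rwa [e] at this
  -- Tracing out `Y` turns the bound on `Q` into the statement that the sum of the `dag (T i) ≫ T i`
  -- is at most `d`.
  have hpos2 := hpos.partialTrace X
  rw [partialTrace_sub, partialTrace_id hC, hQ, partialTrace_sum] at hpos2
  simp only [partialTrace_bend] at hpos2
  obtain ⟨r, hr, hre⟩ := coevTrace_pos (Y := Y) hC hpos2
  rw [map_sub, map_smul, map_sum, hd', hd, smul_eq_mul] at hre
  -- `coevTrace` is not known to be tracial, so the two orders of the product are compared through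
  -- their common C*-norm: at least `1 / d'` since `T i` is a unit vector, and at most `K * s` by
  -- `exists_le_coevTrace`.
  have hb : ∀ i, 1 ≤ d' * (K * (coevTrace Y hC (dag (T i) ≫ T i)).re) := by
    intro i
    set s := (coevTrace Y hC (dag (T i) ≫ T i)).re with hs
    have hs0 : 0 ≤ s := by
      obtain ⟨x, hx, e⟩ := coevTrace_pos (Y := Y) hC (isPos_dag_comp (T i))
      rw [hs, e]; exact hx
    have h1 := hK (dag (T i))
    rw [dag_dag] at h1
    have h2 := norm_le_of_isPos_sub (isPos_dag_comp (T i)) (mul_nonneg hK0 hs0) h1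
    have h3 : (CStarCategory.homNorm _ _).norm (T i ≫ dag (T i)) =
        (CStarCategory.homNorm _ _).norm (dag (T i) ≫ T i) := by
      let _ := endCStarAlgebra X
      have e1 : ‖star (End.of (T i)) * End.of (T i)‖ = ‖End.of (T i)‖ * ‖End.of (T i)‖ :=
        CStarRing.norm_star_mul_self
      have e2 : ‖End.of (T i) * star (End.of (T i))‖ = ‖End.of (T i)‖ * ‖End.of (T i)‖ :=
        CStarRing.norm_self_mul_star
      exact e1.trans e2.symm
    have h4 := isPos_norm_smul_sub (a := T i ≫ dag (T i)) (by rw [dag_comp, dag_dag])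
    obtain ⟨x, hx, e⟩ := coevTrace_pos (Y := Y) hC h4
    rw [map_sub, map_smul, hd', hT', if_pos rfl, smul_eq_mul] at e
    have e' := congrArg Complex.re e
    simp only [Complex.sub_re, Complex.mul_re, Complex.ofReal_re, Complex.ofReal_im,
      Complex.one_re] at e'
    rw [h3] at e'
    nlinarith
  have hsum : (N : ℝ) ≤ ∑ i, d' * (K * (coevTrace Y hC (dag (T i) ≫ T i)).re) := by
    calc (N : ℝ) = ∑ i : Fin N, (1 : ℝ) := by simp
      _ ≤ _ := Finset.sum_le_sum fun i _ => hb i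
  rw [← Finset.mul_sum, ← Finset.mul_sum] at hsum
  have hre' := congrArg Complex.re hre
  simp only [Complex.sub_re, Complex.mul_re, Complex.ofReal_re, Complex.ofReal_im,
    Complex.re_sum] at hre'
  have : (N : ℝ) ≤ d' * (K * (d * d')) := hsum.trans <|
    mul_le_mul_of_nonneg_left (mul_le_mul_of_nonneg_left (by linarith) hK0) hd'0
  exact_mod_cast this.trans (Nat.le_ceil _)

end Trace

end CStarTensorCategory

/-! ### Haploid and C*-Frobenius algebras: standardness and unitarity. -/

namespace CStarTensorCategory

open CStarCategory (dag dag_id dag_comp dag_dag dag_add dag_smul norm_comp_le norm_comp_dag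
  comp_dag_positive)

theorem id_ne_zero_of_unit_ne_zero {C : Type u} [Category.{v} C]
    [Preadditive C] [MonoidalCategory C] {A : Mon C} (h : η[A.X] ≠ 0) : 𝟙 A.X ≠ 0 := fun e =>
  h (by rw [← Category.comp_id η[A.X], e, Limits.comp_zero])

theorem mul_ne_zero_of_unit_ne_zero {C : Type u} [Category.{v} C]
    [Preadditive C] [MonoidalCategory C] [MonoidalPreadditive C] {A : Mon C}
    (h : η[A.X] ≠ 0) : μ[A.X] ≠ 0 := fun e =>
  id_ne_zero_of_unit_ne_zero h (by
    have : 𝟙 A.X = (ρ_ A.X).inv ≫ A.X ◁ η[A.X] ≫ μ[A.X] := by simp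
    rw [this, e]; simp)

section Haploid

variable {C : Type u} [Category.{v} C] [Preadditive C] [Linear ℂ C] [MonoidalCategory C]

theorem IsHaploid.exists_smul_unit {A : Mon C} (hA : IsHaploid A) (h0 : η[A.X] ≠ 0)
    (f : 𝟙_ C ⟶ A.X) : ∃ c : ℂ, f = c • η[A.X] := by
  obtain ⟨c, hc⟩ := (finrank_eq_one_iff_of_nonzero' η[A.X] h0).1 hA f
  exact ⟨c, hc.symm⟩

variable [MonoidalPreadditive C] [MonoidalLinear ℂ C]

/-- A left module endomorphism of a haploid algebra is scalar. -/
theorem IsHaploid.eq_smul_id {A : Mon C} (hA : IsHaploid A) (h0 : η[A.X] ≠ 0) {T : A.X ⟶ A.X}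
    (hT : μ[A.X] ≫ T = A.X ◁ T ≫ μ[A.X]) : ∃ c : ℂ, T = c • 𝟙 A.X := by
  obtain ⟨c, hc⟩ := hA.exists_smul_unit h0 (η[A.X] ≫ T)
  refine ⟨c, ?_⟩
  calc T = (ρ_ A.X).inv ≫ A.X ◁ η[A.X] ≫ μ[A.X] ≫ T := by simp
    _ = (ρ_ A.X).inv ≫ A.X ◁ (η[A.X] ≫ T) ≫ μ[A.X] := by rw [hT]; simp
    _ = c • 𝟙 A.X := by rw [hc]; simp [MonoidalLinear.whiskerLeft_smul]

/-- A morphism to a haploid algebra intertwining right multiplications along `S` is a multiple of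
`S`. -/
theorem IsHaploid.eq_smul_of_intertwines {A B : Mon C} (hB : IsHaploid B) (h0 : η[B.X] ≠ 0)
    {F S : A.X ⟶ B.X} (hF : μ[A.X] ≫ F = (F ⊗ₘ S) ≫ μ[B.X]) : ∃ c : ℂ, F = c • S := by
  obtain ⟨c, hc⟩ := hB.exists_smul_unit h0 (η[A.X] ≫ F)
  refine ⟨c, ?_⟩
  calc F = (λ_ A.X).inv ≫ η[A.X] ▷ A.X ≫ μ[A.X] ≫ F := by simp
    _ = (λ_ A.X).inv ≫ (η[A.X] ≫ F) ▷ A.X ≫ B.X ◁ S ≫ μ[B.X] := by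
        rw [hF, MonoidalCategory.tensorHom_def]; simp
    _ = c • ((λ_ A.X).inv ≫ (𝟙_ C) ◁ S ≫ η[B.X] ▷ B.X ≫ μ[B.X]) := by
        rw [hc, ← whisker_exchange_assoc]; simp [MonoidalLinear.smul_whiskerRight]
    _ = c • S := by simp

end Haploid

variable {C : Type u} [Category.{v} C] [Preadditive C] [Linear ℂ C]
  [MonoidalCategory C] [MonoidalPreadditive C] [MonoidalLinear ℂ C] [CStarTensorCategory C]

theorem IsNormalized.unit_ne_zero (hC : SimpleUnit C) {A : Mon C} (hA : IsNormalized A) :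
    η[A.X] ≠ 0 := by
  intro h
  rw [IsNormalized, h, Limits.zero_comp] at hA
  exact id_unit_ne_zero hC hA.symm

section Frobenius

variable {A B : Mon C}

/-- The second Frobenius relation moves right multiplication past `dag μ`; multiplicativity of `S`
and associativity in `B` finish. This is the hypothesis of `IsHaploid.eq_smul_of_intertwines`. -/
theorem IsCStarFrobenius.mul_comp_intertwiner (hA : IsCStarFrobenius A) {S : A.X ⟶ B.X}
    (hS : μ[A.X] ≫ S = (S ⊗ₘ S) ≫ μ[B.X]) (Z : A.X ⟶ B.X) :
    μ[A.X] ≫ dag μ[A.X] ≫ (Z ⊗ₘ S) ≫ μ[B.X] =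
      ((dag μ[A.X] ≫ (Z ⊗ₘ S) ≫ μ[B.X]) ⊗ₘ S) ≫ μ[B.X] := by
  calc _ = dag μ[A.X] ▷ A.X ≫ (α_ _ _ _).hom ≫ A.X ◁ μ[A.X] ≫ (Z ⊗ₘ S) ≫ μ[B.X] := by
        rw [← Category.assoc, hA.2]; simp
    _ = dag μ[A.X] ▷ A.X ≫ (α_ _ _ _).hom ≫ (Z ⊗ₘ ((S ⊗ₘ S) ≫ μ[B.X])) ≫ μ[B.X] := by
        rw [whiskerLeft_comp_tensorHom_assoc, hS]
    _ = dag μ[A.X] ▷ A.X ≫ (α_ _ _ _).hom ≫ (Z ⊗ₘ (S ⊗ₘ S)) ≫ B.X ◁ μ[B.X] ≫ μ[B.X] := by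
        rw [tensorHom_comp_whiskerLeft_assoc]
    _ = dag μ[A.X] ▷ A.X ≫ ((Z ⊗ₘ S) ⊗ₘ S) ≫ μ[B.X] ▷ B.X ≫ μ[B.X] := by
        rw [MonObj.mul_assoc, associator_naturality_assoc]
    _ = _ := by
        rw [tensorHom_comp_whiskerRight_assoc, whiskerRight_comp_tensorHom_assoc]

theorem IsCStarFrobenius.exists_scalar_intertwiner (hA : IsCStarFrobenius A) (hB : IsHaploid B)
    (h0 : η[B.X] ≠ 0) {S : A.X ⟶ B.X} (hS : μ[A.X] ≫ S = (S ⊗ₘ S) ≫ μ[B.X]) (Z : A.X ⟶ B.X) :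
    ∃ c : ℂ, dag μ[A.X] ≫ (Z ⊗ₘ S) ≫ μ[B.X] = c • S :=
  hB.eq_smul_of_intertwines h0 (hA.mul_comp_intertwiner hS Z)

theorem IsCStarFrobenius.exists_scalar_right (hA : IsCStarFrobenius A) (hA' : IsHaploid A)
    (h0 : η[A.X] ≠ 0) (T : A.X ⟶ A.X) :
    ∃ c : ℂ, dag μ[A.X] ≫ T ▷ A.X ≫ μ[A.X] = c • 𝟙 A.X := by
  have := hA.exists_scalar_intertwiner hA' h0 (S := 𝟙 A.X) (by simp) T
  simpa using this

/-- The first Frobenius relation makes this a left module map. For `T = 𝟙` the conclusion is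
speciality. -/
theorem IsCStarFrobenius.exists_scalar_left (hA : IsCStarFrobenius A) (hA' : IsHaploid A)
    (h0 : η[A.X] ≠ 0) (T : A.X ⟶ A.X) :
    ∃ c : ℂ, dag μ[A.X] ≫ A.X ◁ T ≫ μ[A.X] = c • 𝟙 A.X := by
  refine hA'.eq_smul_id h0 ?_
  calc μ[A.X] ≫ dag μ[A.X] ≫ A.X ◁ T ≫ μ[A.X]
      = A.X ◁ dag μ[A.X] ≫ (α_ _ _ _).inv ≫ μ[A.X] ▷ A.X ≫ A.X ◁ T ≫ μ[A.X] := by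
        rw [← Category.assoc, ← hA.1]; simp
    _ = A.X ◁ dag μ[A.X] ≫ (α_ _ _ _).inv ≫ (A.X ⊗ A.X) ◁ T ≫ μ[A.X] ▷ A.X ≫ μ[A.X] := by
        rw [whisker_exchange_assoc]
    _ = _ := by rw [MonObj.mul_assoc]; simp

/-- The self-duality of a C*-Frobenius algebra. -/
@[reducible] def IsCStarFrobenius.exactPairing (hA : IsCStarFrobenius A) :
    ExactPairing A.X A.X where
  coevaluation' := η[A.X] ≫ dag μ[A.X]
  evaluation' := μ[A.X] ≫ dag η[A.X]
  coevaluation_evaluation' := by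
    have h1 : A.X ◁ dag μ[A.X] ≫ (α_ _ _ _).inv ≫ μ[A.X] ▷ A.X = μ[A.X] ≫ dag μ[A.X] := hA.1
    have h2 : dag μ[A.X] ≫ dag η[A.X] ▷ A.X = (λ_ A.X).inv := by
      rw [← dag_leftUnitor_hom, ← MonObj.one_mul, dag_comp, dag_whiskerRight]
    calc _ = A.X ◁ η[A.X] ≫ (A.X ◁ dag μ[A.X] ≫ (α_ _ _ _).inv ≫ μ[A.X] ▷ A.X) ≫
          dag η[A.X] ▷ A.X := by simp
      _ = _ := by rw [h1, Category.assoc, h2, ← Category.assoc, MonObj.mul_one]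
  evaluation_coevaluation' := by
    have h1 : μ[A.X] ≫ dag μ[A.X] = dag μ[A.X] ▷ A.X ≫ (α_ _ _ _).hom ≫ A.X ◁ μ[A.X] := hA.2
    have h2 : dag μ[A.X] ≫ A.X ◁ dag η[A.X] = (ρ_ A.X).inv := by
      rw [← dag_rightUnitor_hom, ← MonObj.mul_one, dag_comp, dag_whiskerLeft]
    calc _ = η[A.X] ▷ A.X ≫ (dag μ[A.X] ▷ A.X ≫ (α_ _ _ _).hom ≫ A.X ◁ μ[A.X]) ≫
          A.X ◁ dag η[A.X] := by simp
      _ = _ := by rw [← h1, Category.assoc, h2, ← Category.assoc, MonObj.one_mul]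

theorem IsCStarFrobenius.isRigid (hA : IsCStarFrobenius A) (hn : IsNormalized A) : IsRigid A :=
  ⟨dag η[A.X], hn, hA.exactPairing, rfl⟩

/-- Normalized haploid C*-Frobenius algebras are standard. -/
theorem IsCStarFrobenius.isStandard (hC : SimpleUnit C) (hA : IsCStarFrobenius A)
    (hA' : IsHaploid A) (hn : IsNormalized A) : IsStandard A := by
  have h0 := hn.unit_ne_zero hC
  refine ⟨hA.exactPairing, rfl, rfl, fun T => ?_⟩
  obtain ⟨a, ha⟩ := hA.exists_scalar_right hA' h0 T
  obtain ⟨b, hb⟩ := hA.exists_scalar_left hA' h0 T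
  obtain ⟨d, hd⟩ := hA.exists_scalar_left hA' h0 (𝟙 A.X)
  have hd' : dag μ[A.X] ≫ μ[A.X] = d • 𝟙 A.X := by simpa using hd
  have hd0 : d ≠ 0 := by
    rintro rfl
    rw [zero_smul] at hd'
    exact mul_ne_zero_of_unit_ne_zero h0 (eq_zero_of_dag_comp hd')
  have hassoc : dag μ[A.X] ≫ dag μ[A.X] ▷ A.X = dag μ[A.X] ≫ A.X ◁ dag μ[A.X] ≫ (α_ _ _ _).inv := by
    have := congrArg dag (MonObj.mul_assoc A.X)
    rw [dag_comp, dag_comp, dag_comp, dag_whiskerLeft, dag_whiskerRight, dag_associator_hom,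
      Category.assoc] at this
    exact this
  -- Both sides are 1 ⊗ T ⊗ 1 between the threefold product and its adjoint, bracketed in two ways.
  have key : dag μ[A.X] ≫ A.X ◁ (dag μ[A.X] ≫ T ▷ A.X ≫ μ[A.X]) ≫ μ[A.X] =
      dag μ[A.X] ≫ (dag μ[A.X] ≫ A.X ◁ T ≫ μ[A.X]) ▷ A.X ≫ μ[A.X] := by
    symm
    calc _ = (dag μ[A.X] ≫ dag μ[A.X] ▷ A.X) ≫ (A.X ◁ T) ▷ A.X ≫ μ[A.X] ▷ A.X ≫ μ[A.X] := by simp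
      _ = _ := by rw [hassoc, MonObj.mul_assoc]; simp
  rw [ha, hb, MonoidalLinear.whiskerLeft_smul, MonoidalLinear.smul_whiskerRight] at key
  simp only [whiskerLeft_id, id_whiskerRight, Linear.smul_comp, Linear.comp_smul,
    Category.id_comp, hd', smul_smul] at key
  have hab : a = b := by
    have h1 : (a * d) • 𝟙 A.X = (b * d) • 𝟙 A.X := key
    have h2 := smul_left_injective ℂ (id_ne_zero_of_unit_ne_zero h0) h1
    exact mul_right_cancel₀ hd0 h2
  change dag (μ[A.X] ≫ dag η[A.X]) ≫ A.X ◁ T ≫ μ[A.X] ≫ dag η[A.X] =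
    (η[A.X] ≫ dag μ[A.X]) ≫ T ▷ A.X ≫ dag (η[A.X] ≫ dag μ[A.X])
  have e1 : dag (μ[A.X] ≫ dag η[A.X]) ≫ A.X ◁ T ≫ μ[A.X] ≫ dag η[A.X] =
      η[A.X] ≫ (dag μ[A.X] ≫ A.X ◁ T ≫ μ[A.X]) ≫ dag η[A.X] := by simp [dag_comp, dag_dag]
  have e2 : (η[A.X] ≫ dag μ[A.X]) ≫ T ▷ A.X ≫ dag (η[A.X] ≫ dag μ[A.X]) =
      η[A.X] ≫ (dag μ[A.X] ≫ T ▷ A.X ≫ μ[A.X]) ≫ dag η[A.X] := by simp [dag_comp, dag_dag]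
  rw [e1, e2, ha, hb, hab]

/-- Equivalences between normalized haploid C*-Frobenius algebras are unitary. -/
theorem IsEquivalence.isUnitary (hC : SimpleUnit C) (hA : IsCStarFrobenius A)
    (hnA : IsNormalized A) (hB : IsCStarFrobenius B)
    (hB' : IsHaploid B) (hnB : IsNormalized B) {S : A.X ≅ B.X} (hS : IsEquivalence A B S) :
    IsUnitary S.hom := by
  have h0 := hnB.unit_ne_zero hC
  obtain ⟨c, hc⟩ := hA.exists_scalar_intertwiner hB' h0 hS.1 (dag S.inv)
  obtain ⟨k₀, hk₀⟩ := hB.exists_scalar_left hB' h0 (dag S.hom ≫ S.hom)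
  have hinv : μ[B.X] ≫ S.inv = (S.inv ⊗ₘ S.inv) ≫ μ[A.X] := hS.symm.1
  -- The adjoint of this morphism is the one evaluated in `hc`, so evaluating it from the side of
  -- `B` compares `S.hom` with `dag S.inv`.
  have e1 : dag μ[B.X] ≫ (S.inv ⊗ₘ dag S.hom) ≫ μ[A.X] = k₀ • S.inv := by
    have : (S.inv ⊗ₘ dag S.hom) ≫ μ[A.X] = B.X ◁ (dag S.hom ≫ S.hom) ≫ μ[B.X] ≫ S.inv := by
      rw [hinv, whiskerLeft_comp_tensorHom_assoc]; simp
    rw [this]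
    calc _ = (dag μ[B.X] ≫ B.X ◁ (dag S.hom ≫ S.hom) ≫ μ[B.X]) ≫ S.inv := by
          simp only [Category.assoc]
      _ = _ := by rw [hk₀]; simp
  have e2 : c • S.hom = conj k₀ • dag S.inv := by
    have := congrArg dag e1
    rw [dag_smul, dag_comp, dag_comp, dag_tensorHom, dag_dag, dag_dag, Category.assoc, hc] at this
    exact this
  have hk₀0 : conj k₀ ≠ 0 := by
    intro h
    have h' : k₀ = 0 := by simpa using h
    rw [h', zero_smul] at hk₀
    -- The sandwich with scalar `k₀` has the form `dag v ≫ v`. Its vanishing would give `v = 0`,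
    -- hence `μ[B.X] = 0` as `S` is invertible.
    have h2 : dag (B.X ◁ S.hom ≫ μ[B.X]) ≫ B.X ◁ S.hom ≫ μ[B.X] = 0 := by
      rw [← hk₀]; simp [dag_comp, dag_whiskerLeft]
    have h3 := eq_zero_of_dag_comp h2
    apply mul_ne_zero_of_unit_ne_zero h0
    rw [← cancel_epi (B.X ◁ S.hom), h3, Limits.comp_zero]
  have e3 : ∃ k : ℂ, dag S.inv = k • S.hom := by
    refine ⟨(conj k₀)⁻¹ * c, ?_⟩
    rw [mul_smul, e2, smul_smul, inv_mul_cancel₀ hk₀0, one_smul]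
  obtain ⟨k, hk⟩ := e3
  have e4 : S.inv = conj k • dag S.hom := by rw [← dag_dag S.inv, hk, dag_smul]
  have e5 : η[B.X] = η[A.X] ≫ S.hom := hS.2.symm
  have e6 : conj k = 1 := by
    apply smul_id_unit_injective hC
    rw [one_smul]
    have hA1 : η[A.X] ≫ dag η[A.X] = 𝟙 _ := hnA
    have hB1 : η[B.X] ≫ dag η[B.X] = 𝟙 _ := hnB
    conv_lhs => rw [← hB1, e5, dag_comp, Category.assoc, ← Linear.comp_smul, ← Linear.comp_smul,
      ← Linear.smul_comp, ← e4]
    simpa using hA1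
  rw [e6, one_smul] at e4
  exact ⟨by rw [← e4]; simp, by rw [← e4]; simp⟩

end Frobenius

end CStarTensorCategory

/-! ### Bending actions, and the twisted Frobenius relation. -/

namespace CStarTensorCategory

open CStarCategory (dag dag_id dag_comp dag_dag dag_add dag_smul norm_comp_le norm_comp_dag
  comp_dag_positive)

section Bending

variable {C : Type u} [Category.{v} C] [MonoidalCategory C] {V Y : C} [ExactPairing V Y]

theorem tensorRightHomEquiv_symm_eq {W Z : C} (f : W ⟶ Z ⊗ Y) :
    (tensorRightHomEquiv W V Y Z).symm f =
      f ▷ V ≫ (α_ _ _ _).hom ≫ Z ◁ ε_ V Y ≫ (ρ_ Z).hom := rfl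

theorem tensorRightHomEquiv_symm_comp_whiskerRight {W Z Z' : C} (f : W ⟶ Z ⊗ Y) (g : Z ⟶ Z') :
    (tensorRightHomEquiv W V Y Z').symm (f ≫ g ▷ Y) =
      (tensorRightHomEquiv W V Y Z).symm f ≫ g := by
  rw [Equiv.symm_apply_eq, tensorRightHomEquiv_naturality, Equiv.apply_symm_apply]

theorem tensorRightHomEquiv_symm_whiskerLeft {W Z : C} (X : C) (f : W ⟶ Z ⊗ Y) :
    (tensorRightHomEquiv (X ⊗ W) V Y (X ⊗ Z)).symm (X ◁ f ≫ (α_ _ _ _).inv) =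
      (α_ _ _ _).hom ≫ X ◁ (tensorRightHomEquiv W V Y Z).symm f := by
  simp only [tensorRightHomEquiv_symm_eq]
  monoidal

/-- The free action on `Z ⊗ Y` attached to an action on `Z`. -/
def freeAction {X Z : C} (Y : C) (n : X ⊗ Z ⟶ Z) : X ⊗ (Z ⊗ Y) ⟶ Z ⊗ Y :=
  (α_ _ _ _).inv ≫ n ▷ Y

/-- Bending moves the right factor `Y`, while the free action involves only `Z`; hence the two are
compatible. -/
theorem tensorRightHomEquiv_symm_freeAction {W X Z : C} (n : X ⊗ Z ⟶ Z) (f : W ⟶ Z ⊗ Y) :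
    (tensorRightHomEquiv (X ⊗ W) V Y Z).symm (X ◁ f ≫ freeAction Y n) =
      (α_ _ _ _).hom ≫ X ◁ (tensorRightHomEquiv W V Y Z).symm f ≫ n := by
  rw [freeAction, ← Category.assoc, tensorRightHomEquiv_symm_comp_whiskerRight,
    tensorRightHomEquiv_symm_whiskerLeft, Category.assoc]

/-- The representation of an algebra on `V ⊗ Y` attached to an action on `V` is multiplicative. -/
theorem whiskerLeft_representation_freeAction {A : Mon C} (n : A.X ⊗ V ⟶ V)
    (hn : μ[A.X] ▷ V ≫ n = (α_ _ _ _).hom ≫ A.X ◁ n ≫ n) :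
    A.X ◁ tensorRightHomEquiv A.X V Y V n ≫ freeAction Y n =
      μ[A.X] ≫ tensorRightHomEquiv A.X V Y V n := by
  apply (tensorRightHomEquiv _ V Y V).symm.injective
  rw [tensorRightHomEquiv_symm_freeAction, tensorRightHomEquiv_symm_naturality,
    Equiv.symm_apply_apply, hn]

end Bending

variable {C : Type u} [Category.{v} C] [Preadditive C] [Linear ℂ C]
  [MonoidalCategory C] [MonoidalPreadditive C] [MonoidalLinear ℂ C] [CStarTensorCategory C]

theorem dag_freeAction {X Z : C} (Y : C) (n : X ⊗ Z ⟶ Z) :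
    dag (freeAction Y n) = dag n ▷ Y ≫ (α_ _ _ _).hom := by
  rw [freeAction, dag_comp, dag_whiskerRight, dag_associator_inv]

section Module

variable {V Y : C} [ExactPairing V Y]

theorem tensorRightHomEquiv_symm_zero {C : Type u} [Category.{v} C] [Preadditive C]
    [MonoidalCategory C] [MonoidalPreadditive C] {V Y : C} [ExactPairing V Y] (W Z : C) :
    (tensorRightHomEquiv W V Y Z).symm 0 = 0 := by
  rw [tensorRightHomEquiv_symm_eq]; simp

variable (V) in
theorem partialTrace_eq {Z : C} (a : Z ⊗ Y ⟶ Z ⊗ Y) :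
    partialTrace (X := V) Z a = dag ((tensorRightHomEquiv (Z ⊗ Y) V Y Z).symm (𝟙 _)) ≫
      (tensorRightHomEquiv (Z ⊗ Y) V Y Z).symm a := by
  simp [tensorRightHomEquiv_symm_eq, partialTrace, dag_comp, dag_whiskerLeft, dag_associator_hom,
    dag_rightUnitor_hom]

variable (V) in
-- Tracing out `Y` leaves the action on `Z` untouched. This carries inequalities from `Z ⊗ Y` down
-- to `Z`.
theorem partialTrace_freeAction {X Z : C} (n : X ⊗ Z ⟶ Z) (a : Z ⊗ Y ⟶ Z ⊗ Y) :
    partialTrace (X := V) Z (dag (freeAction Y n) ≫ X ◁ a ≫ freeAction Y n) =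
      dag n ≫ X ◁ partialTrace (X := V) Z a ≫ n := by
  rw [partialTrace_eq, partialTrace_eq, tensorRightHomEquiv_symm_naturality,
    tensorRightHomEquiv_symm_freeAction]
  have h : dag ((tensorRightHomEquiv (Z ⊗ Y) V Y Z).symm (𝟙 _)) ≫ dag (freeAction Y n) ▷ V =
      dag n ≫ X ◁ dag ((tensorRightHomEquiv (Z ⊗ Y) V Y Z).symm (𝟙 _)) ≫ (α_ _ _ _).inv := by
    rw [← dag_whiskerRight, ← dag_comp, ← tensorRightHomEquiv_symm_naturality, Category.comp_id]
    have := tensorRightHomEquiv_symm_freeAction (V := V) n (𝟙 (Z ⊗ Y))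
    rw [MonoidalCategory.whiskerLeft_id, Category.id_comp] at this
    rw [this, dag_comp, dag_comp, dag_whiskerLeft, dag_associator_hom, Category.assoc]
  rw [← Category.assoc, h]
  simp

/-- The key relation: for an action `n` of `A` on `V` such that `n n*` is scalar and every
superharmonic positive endomorphism of `V` is harmonic, the positive endomorphism `b = π* π`
attached to the representation `π` of `A` on `V ⊗ Y` twists the C*-Frobenius relation. -/
theorem twisted_frobenius {A : Mon C} (n : A.X ⊗ V ⟶ V)
    (hassoc : μ[A.X] ▷ V ≫ n = (α_ _ _ _).hom ≫ A.X ◁ n ≫ n) (l : ℝ)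
    (hn : dag n ≫ n = (l : ℂ) • 𝟙 V)
    (hrig : ∀ p : V ⟶ V, IsPos p → IsPos ((l : ℂ) • p - dag n ≫ A.X ◁ p ≫ n) →
      dag n ≫ A.X ◁ p ≫ n = (l : ℂ) • p)
    {b b' : A.X ⟶ A.X}
    (hb : b = tensorRightHomEquiv A.X V Y V n ≫ dag (tensorRightHomEquiv A.X V Y V n))
    (h1 : b ≫ b' = 𝟙 _) (h2 : b' ≫ b = 𝟙 _) :
    μ[A.X] ≫ b ≫ dag μ[A.X] =
      (b ≫ dag μ[A.X] ≫ A.X ◁ b') ▷ A.X ≫ (α_ _ _ _).hom ≫ A.X ◁ (μ[A.X] ≫ b) := by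
  have hNπ := whiskerLeft_representation_freeAction (Y := Y) n hassoc
  have hsymm : (tensorRightHomEquiv A.X V Y V).symm (tensorRightHomEquiv A.X V Y V n) = n :=
    Equiv.symm_apply_apply _ _
  set π := tensorRightHomEquiv A.X V Y V n with hπ
  set N := freeAction Y n with hN
  have hbd : dag b = b := by rw [hb, dag_comp, dag_dag]
  have hbd' : dag b' = b' := by
    have e : dag b' ≫ b = 𝟙 _ := by
      conv_lhs => rw [← hbd]
      rw [← dag_comp, h1, dag_id]
    calc dag b' = dag b' ≫ b ≫ b' := by rw [h1, Category.comp_id]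
      _ = b' := by rw [← Category.assoc, e, Category.id_comp]
  -- `P` is the range projection of `π`; `hPN` below expresses invariance of this range under the
  -- free action.
  obtain ⟨P, hP⟩ : ∃ P : V ⊗ Y ⟶ V ⊗ Y, P = dag π ≫ b' ≫ π := ⟨_, rfl⟩
  have hPd : dag P = P := by simp [hP, dag_comp, dag_dag, hbd']
  have hπP : π ≫ P = π := by
    rw [hP, ← Category.assoc, ← hb, ← Category.assoc, h1, Category.id_comp]
  have hPπ : P ≫ dag π = dag π := by
    rw [hP, Category.assoc, Category.assoc, ← hb, h2, Category.comp_id]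
  have hPP : P ≫ P = P := by
    have e : (dag π ≫ b' ≫ π) ≫ P = P := by rw [Category.assoc, Category.assoc, hπP, hP]
    rwa [← hP] at e
  have hPN : A.X ◁ P ≫ N ≫ P = A.X ◁ P ≫ N := by
    rw [hP, MonoidalCategory.whiskerLeft_comp, MonoidalCategory.whiskerLeft_comp]
    simp only [Category.assoc]
    rw [reassoc_of% hNπ, hNπ, ← hP, hπP]
  have hNN : dag N ≫ N = (l : ℂ) • 𝟙 _ := by
    rw [hN, dag_freeAction, freeAction]
    simp only [Category.assoc, Iso.hom_inv_id_assoc]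
    rw [← comp_whiskerRight, hn, MonoidalLinear.smul_whiskerRight, id_whiskerRight]
  -- `f` is the corner of the action leading from the complement of `P` into `P`; it vanishes
  -- exactly when `P` commutes with the action.
  obtain ⟨f, hf⟩ : ∃ f : A.X ⊗ (V ⊗ Y) ⟶ V ⊗ Y, f = A.X ◁ (𝟙 _ - P) ≫ N ≫ P := ⟨_, rfl⟩
  have hff : dag f ≫ f = (l : ℂ) • P - dag N ≫ A.X ◁ P ≫ N := by
    have hf' : f = N ≫ P - A.X ◁ P ≫ N := by
      rw [hf, whiskerLeft_sub, Preadditive.sub_comp, hPN, MonoidalCategory.whiskerLeft_id,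
        Category.id_comp]
    have a1 : P ≫ dag N ≫ N ≫ P = (l : ℂ) • P := by
      rw [← Category.assoc (dag N), hNN, Linear.smul_comp, Linear.comp_smul, Category.id_comp, hPP]
    have a2 : P ≫ dag N ≫ A.X ◁ P ≫ N = dag N ≫ A.X ◁ P ≫ N := by
      have a := congrArg dag hPN
      rw [dag_comp, dag_comp, dag_comp, dag_whiskerLeft, hPd, Category.assoc] at a
      rw [reassoc_of% a]
    have a3 : dag N ≫ A.X ◁ P ≫ N ≫ P = dag N ≫ A.X ◁ P ≫ N := by rw [hPN]
    have a4 : dag N ≫ A.X ◁ P ≫ A.X ◁ P ≫ N = dag N ≫ A.X ◁ P ≫ N := by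
      rw [← MonoidalCategory.whiskerLeft_comp_assoc, hPP]
    rw [hf', dag_sub, dag_comp, dag_comp, dag_whiskerLeft, hPd]
    simp only [Preadditive.sub_comp, Preadditive.comp_sub, Category.assoc]
    rw [a1, a2, a3, a4]
    abel
  -- The partial trace of `P` is superharmonic, with defect the partial trace of `dag f ≫ f`. By
  -- `hrig` the defect is zero, so the bent form of `f` vanishes.
  have hf0 : f = 0 := by
    have t1 := partialTrace_dag_comp (X := V) f
    rw [hff, partialTrace_sub, partialTrace_smul, partialTrace_freeAction] at t1
    have t2 := isPos_dag_comp ((tensorRightHomEquiv _ V Y V).symm f)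
    rw [← t1] at t2
    have hPpos : IsPos P := by
      have := isPos_dag_comp P
      rwa [hPd, hPP] at this
    have t3 := hrig _ (hPpos.partialTrace V) t2
    rw [t3, sub_self] at t1
    have t4 := eq_zero_of_dag_comp t1.symm
    rw [← tensorRightHomEquiv_symm_zero (V := V) (Y := Y)] at t4
    exact (tensorRightHomEquiv _ V Y V).symm.injective t4
  have hNP : N ≫ P = A.X ◁ P ≫ N := by
    rw [hf, whiskerLeft_sub, Preadditive.sub_comp, hPN, MonoidalCategory.whiskerLeft_id,
      Category.id_comp] at hf0
    exact sub_eq_zero.1 hf0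
  have hstar : N ≫ dag π = A.X ◁ (dag π ≫ b') ≫ μ[A.X] ≫ b := by
    calc N ≫ dag π = (N ≫ P) ≫ dag π := by rw [Category.assoc, hPπ]
      _ = A.X ◁ (dag π ≫ b') ≫ (A.X ◁ π ≫ N) ≫ dag π := by
          rw [hNP, hP]; simp
      _ = _ := by rw [hNπ, Category.assoc, ← hb]
  obtain ⟨c, hc⟩ : ∃ c : A.X ⟶ A.X ⊗ A.X, c = b ≫ dag μ[A.X] ≫ A.X ◁ b' := ⟨_, rfl⟩
  have hadj : π ≫ dag N = c ≫ A.X ◁ π := by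
    have := congrArg dag hstar
    simp only [dag_comp, dag_whiskerLeft, dag_dag, hbd, hbd'] at this
    rw [this, hc]; simp
  -- Unbending `hadj` gives a Frobenius relation for the action `n` itself, with `c` in place of the
  -- comultiplication.
  have hnn : n ≫ dag n = c ▷ V ≫ (α_ _ _ _).hom ≫ A.X ◁ n := by
    have e1 : (tensorRightHomEquiv A.X V Y (A.X ⊗ V)).symm (π ≫ dag n ▷ Y) = n ≫ dag n := by
      rw [tensorRightHomEquiv_symm_comp_whiskerRight, hsymm]
    have e2 : π ≫ dag n ▷ Y = c ≫ A.X ◁ π ≫ (α_ _ _ _).inv := by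
      rw [← Category.assoc c, ← hadj, hN, dag_freeAction]; simp
    rw [← e1, e2, tensorRightHomEquiv_symm_naturality, tensorRightHomEquiv_symm_whiskerLeft, hsymm]
  have hNNd : N ≫ dag N = c ▷ (V ⊗ Y) ≫ (α_ _ _ _).hom ≫ A.X ◁ N := by
    rw [hN, dag_freeAction, freeAction]
    simp only [Category.assoc]
    rw [← comp_whiskerRight_assoc, hnn]
    simp
  -- Since `π` intertwines multiplication with the free action, the relation for `N` compressed by
  -- `π` becomes one for the multiplication.
  calc μ[A.X] ≫ b ≫ dag μ[A.X] = (μ[A.X] ≫ π) ≫ dag (μ[A.X] ≫ π) := by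
        rw [hb, dag_comp]; simp
    _ = A.X ◁ π ≫ (N ≫ dag N) ≫ A.X ◁ dag π := by
        rw [← hNπ, dag_comp, dag_whiskerLeft]; simp
    _ = c ▷ A.X ≫ (A.X ⊗ A.X) ◁ π ≫ (α_ _ _ _).hom ≫ A.X ◁ (N ≫ dag π) := by
        rw [hNNd]; simp only [Category.assoc]; rw [whisker_exchange_assoc]; simp
    _ = c ▷ A.X ≫ (α_ _ _ _).hom ≫ A.X ◁ ((A.X ◁ π ≫ N) ≫ dag π) := by simp
    _ = _ := by rw [hNπ, Category.assoc, ← hb, hc]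

end Module

/-- Transport of an algebra structure along an automorphism. -/
@[reducible] def transport {C : Type u} [Category.{v} C] [MonoidalCategory C]
    (A : Mon C) (w : A.X ≅ A.X) : Mon C :=
  { X := A.X, mon := MonObj.ofIso w }

theorem isEquivalence_transport {C : Type u} [Category.{v} C] [MonoidalCategory C]
    {A : Mon C} (w : A.X ≅ A.X) : IsEquivalence A (transport A w) w := by
  constructor
  · change μ[A.X] ≫ w.hom = (w.hom ⊗ₘ w.hom) ≫ (w.inv ⊗ₘ w.inv) ≫ μ[A.X] ≫ w.hom
    simp
  · rfl

/-! ### From rigid haploid algebras to Q-systems. -/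

section Existence

variable {A : Mon C}

/-- The positive map `T ↦ m (1 ⊗ T) m*`. -/
def mulMap (A : Mon C) : (A.X ⟶ A.X) →ₗ[ℂ] (A.X ⟶ A.X) where
  toFun T := dag μ[A.X] ≫ A.X ◁ T ≫ μ[A.X]
  map_add' S T := by simp [MonoidalPreadditive.whiskerLeft_add]
  map_smul' c T := by simp [MonoidalLinear.whiskerLeft_smul]

theorem mulMap_apply (T : A.X ⟶ A.X) : mulMap A T = dag μ[A.X] ≫ A.X ◁ T ≫ μ[A.X] := rfl

theorem isPos_mulMap {T : A.X ⟶ A.X} (hT : IsPos T) : IsPos (mulMap A T) := by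
  obtain ⟨t, rfl⟩ := hT
  convert isPos_dag_comp (A.X ◁ dag t ≫ μ[A.X]) using 1
  simp [mulMap_apply, dag_comp, dag_whiskerLeft, dag_dag]

/-- The kernel of a superharmonic positive endomorphism is a left ideal. -/
theorem whiskerLeft_mul_eq_zero {q : A.X ⟶ A.X} {l : ℝ} (hq : IsPos q)
    (hl : IsPos ((l : ℂ) • q - mulMap A q)) {Z : C} {x : A.X ⟶ Z} (hx : q ≫ x = 0) :
    A.X ◁ q ≫ μ[A.X] ≫ x = 0 := by
  obtain ⟨t, rfl⟩ := hq
  have e : dag x ≫ mulMap A (t ≫ dag t) ≫ x =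
      dag (A.X ◁ dag t ≫ μ[A.X] ≫ x) ≫ A.X ◁ dag t ≫ μ[A.X] ≫ x := by
    simp [mulMap_apply, dag_comp, dag_whiskerLeft, dag_dag]
  -- Compressing the superharmonic inequality by `x` kills its `q` term, so a positive endomorphism
  -- has a positive negative.
  have h1 : IsPos (-(dag x ≫ mulMap A (t ≫ dag t) ≫ x)) := by
    have := hl.conj x
    rw [Preadditive.sub_comp, Preadditive.comp_sub, Linear.smul_comp, hx] at this
    simpa using this
  have h2 : IsPos (dag x ≫ mulMap A (t ≫ dag t) ≫ x) := by rw [e]; exact isPos_dag_comp _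
  have h3 := h2.eq_zero h1
  rw [e] at h3
  have h4 := eq_zero_of_dag_comp h3
  rw [MonoidalCategory.whiskerLeft_comp, Category.assoc, h4, Limits.comp_zero]

/-- The positive map of a rigid haploid algebra is irreducible. -/
theorem mulMap_irreducible (hA : IsHaploid A) [Module.Finite ℂ (A.X ⟶ A.X)] (h0 : η[A.X] ≠ 0)
    {e : A.X ⟶ 𝟙_ C} {p : ExactPairing A.X A.X} (hp : p.evaluation' = μ[A.X] ≫ e)
    {q : A.X ⟶ A.X} {l : ℝ} (hq : IsPos q) (hl : IsPos ((l : ℂ) • q - mulMap A q)) :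
    q = 0 ∨ IsIso q := by
  by_contra! hcon
  obtain ⟨hq0, hqi⟩ := hcon
  have hx : ∃ x : A.X ⟶ A.X, q ≫ x = 0 ∧ x ≠ 0 := by
    by_contra! h
    exact hqi (isIso_of_comp_right_cancel q h)
  obtain ⟨x, hx, hx0⟩ := hx
  obtain ⟨c, hc⟩ := hA.exists_smul_unit h0 (dag e ≫ q)
  -- If `q` met `dag e` in a nonzero multiple of the unit, inserting `dag e` into the ideal property
  -- would recover `x` and force `x = 0`.
  have hc0 : c = 0 := by
    by_contra hc0
    apply hx0
    have h1 := whiskerLeft_mul_eq_zero hq hl hx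
    have h2 : (ρ_ A.X).inv ≫ A.X ◁ (dag e ≫ q) ≫ μ[A.X] ≫ x = 0 := by
      rw [MonoidalCategory.whiskerLeft_comp, Category.assoc, h1]; simp
    rw [hc, MonoidalLinear.whiskerLeft_smul, Linear.smul_comp, Linear.comp_smul] at h2
    have h3 := (smul_eq_zero.1 h2).resolve_left hc0
    simpa using h3
  have hqe : q ≫ e = 0 := by
    apply eq_zero_of_dag_eq_zero
    rw [dag_comp, hq.dag_eq, hc, hc0, zero_smul]
  have h1 := whiskerLeft_mul_eq_zero hq hl hqe
  rw [← hp] at h1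
  apply hq0
  -- Now `q` is killed by the evaluation pairing, and the conjugate equation recovers `q` from that
  -- pairing.
  have h2 := p.evaluation_coevaluation'
  have h3 : (𝟙_ C) ◁ q ≫ (λ_ A.X).hom ≫ (ρ_ A.X).inv = 0 := by
    rw [← h2, whisker_exchange_assoc, associator_naturality_right_assoc,
      ← MonoidalCategory.whiskerLeft_comp, h1]
    simp
  rw [leftUnitor_naturality_assoc] at h3
  have h4 := congrArg (fun z => (λ_ A.X).inv ≫ z ≫ (ρ_ A.X).hom) h3
  simpa using h4

/-- Every rigid haploid algebra satisfies a twisted C*-Frobenius relation. -/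
theorem exists_twisted_frobenius (hC : SimpleUnit C) (hA : IsHaploid A) (hr : IsRigid A) :
    ∃ b b' : A.X ⟶ A.X, IsPos b ∧ b ≫ b' = 𝟙 _ ∧ b' ≫ b = 𝟙 _ ∧
      μ[A.X] ≫ b ≫ dag μ[A.X] =
        (b ≫ dag μ[A.X] ≫ A.X ◁ b') ▷ A.X ≫ (α_ _ _ _).hom ≫ A.X ◁ (μ[A.X] ≫ b) := by
  obtain ⟨e, he, p, hp⟩ := hr
  have h0 : η[A.X] ≠ 0 := fun h => id_unit_ne_zero hC (by rw [← he, h, Limits.zero_comp])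
  have hfin : Module.Finite ℂ (A.X ⟶ A.X) := finite_end_of_exactPairing A.X A.X hC
  obtain ⟨t, l, ht, hl, hrig⟩ := exists_positive_eigenvector (id_ne_zero_of_unit_ne_zero h0)
    (mulMap A) (fun _ h => isPos_mulMap h) (fun q l => mulMap_irreducible hA h0 hp)
  -- This is the regular action conjugated by `t`; the eigenvector equation becomes `dag n ≫ n = l •
  -- 𝟙`.
  set n : A.X ⊗ A.X ⟶ A.X := A.X ◁ t ≫ μ[A.X] ≫ inv t with hn
  have hdt : dag (inv t) ≫ dag t = 𝟙 _ := by rw [← dag_comp, IsIso.hom_inv_id, dag_id]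
  have hdt' : dag t ≫ dag (inv t) = 𝟙 _ := by rw [← dag_comp, IsIso.inv_hom_id, dag_id]
  have hmul : ∀ q : A.X ⟶ A.X, dag n ≫ A.X ◁ q ≫ n =
      dag (inv t) ≫ mulMap A (dag t ≫ q ≫ t) ≫ inv t := fun q => by
    simp [hn, mulMap_apply, dag_comp, dag_whiskerLeft]
  have hassoc : μ[A.X] ▷ A.X ≫ n = (α_ _ _ _).hom ≫ A.X ◁ n ≫ n := by
    have e : A.X ◁ (A.X ◁ t ≫ μ[A.X] ≫ inv t) ≫ A.X ◁ t = A.X ◁ A.X ◁ t ≫ A.X ◁ μ[A.X] := by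
      rw [← MonoidalCategory.whiskerLeft_comp]; simp
    rw [hn, ← whisker_exchange_assoc, reassoc_of% (MonObj.mul_assoc A.X), reassoc_of% e]
    simp
  have hnn : dag n ≫ n = (l : ℂ) • 𝟙 _ := by
    have := hmul (𝟙 _)
    rw [Category.id_comp, hl, MonoidalCategory.whiskerLeft_id, Category.id_comp] at this
    rw [this, Linear.smul_comp, Linear.comp_smul, Category.assoc, IsIso.hom_inv_id,
      Category.comp_id, hdt]
  have hrig' : ∀ q : A.X ⟶ A.X, IsPos q → IsPos ((l : ℂ) • q - dag n ≫ A.X ◁ q ≫ n) →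
      dag n ≫ A.X ◁ q ≫ n = (l : ℂ) • q := fun q hq hle => by
    have h1 := hle.conj t
    have h2 : dag t ≫ ((l : ℂ) • q - dag n ≫ A.X ◁ q ≫ n) ≫ t =
        (l : ℂ) • (dag t ≫ q ≫ t) - mulMap A (dag t ≫ q ≫ t) := by
      rw [hmul, Preadditive.sub_comp, Preadditive.comp_sub, Linear.smul_comp, Linear.comp_smul]
      simp only [Category.assoc, IsIso.inv_hom_id, Category.comp_id]
      rw [reassoc_of% hdt']
    rw [h2] at h1
    rw [hmul, hrig _ (hq.conj t) h1, Linear.smul_comp, Linear.comp_smul]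
    simp only [Category.assoc, IsIso.hom_inv_id, Category.comp_id]
    rw [reassoc_of% hdt]
  set π := tensorRightHomEquiv A.X A.X A.X A.X n with hπ
  -- `π` is faithful because the algebra is unital: a morphism killed by `π` is recovered by acting
  -- on `η ≫ inv t`.
  have hb : IsIso (π ≫ dag π) := by
    refine isIso_of_comp_right_cancel _ fun x hx => ?_
    apply eq_zero_of_dag_eq_zero
    have h1 : dag x ≫ π = 0 := by
      apply eq_zero_of_comp_dag
      rw [dag_comp, dag_dag, Category.assoc, ← Category.assoc π, hx, Limits.comp_zero]
    have h2 : dag x ▷ A.X ≫ n = 0 := by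
      have := tensorRightHomEquiv_symm_naturality (Y := A.X) (Y' := A.X) (dag x) π
      rw [h1, tensorRightHomEquiv_symm_zero, hπ, Equiv.symm_apply_apply] at this
      exact this.symm
    have h3 : dag x ≫ inv t = (ρ_ _).inv ≫ A.X ◁ (η[A.X] ≫ inv t) ≫ dag x ▷ A.X ≫ n := by
      rw [whisker_exchange_assoc, hn, ← MonoidalCategory.whiskerLeft_comp_assoc]
      simp
    rw [h2, Limits.comp_zero, Limits.comp_zero] at h3
    simpa using congrArg (fun z => z ≫ t) h3
  exact ⟨π ≫ dag π, inv (π ≫ dag π), isPos_comp_dag π, IsIso.hom_inv_id _, IsIso.inv_hom_id _,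
    twisted_frobenius n hassoc l hnn hrig' rfl (IsIso.hom_inv_id _) (IsIso.inv_hom_id _)⟩

/-- The two Frobenius relations are adjoint to each other. -/
theorem isCStarFrobenius_of_right (hA : μ[A.X] ≫ dag μ[A.X] =
    dag μ[A.X] ▷ A.X ≫ (α_ A.X A.X A.X).hom ≫ A.X ◁ μ[A.X]) : IsCStarFrobenius A := by
  refine ⟨?_, hA⟩
  have := congrArg dag hA
  simp only [dag_comp, dag_dag, dag_whiskerLeft, dag_whiskerRight, dag_associator_hom,
    Category.assoc] at this
  exact this.symm

/-- A twisted C*-Frobenius relation is straightened by transporting along a square root. -/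
theorem isCStarFrobenius_transport {b b' : A.X ⟶ A.X} (w : A.X ≅ A.X)
    (hw : b = w.hom ≫ dag w.hom) (h1 : b ≫ b' = 𝟙 _)
    (h : μ[A.X] ≫ b ≫ dag μ[A.X] =
      (b ≫ dag μ[A.X] ≫ A.X ◁ b') ▷ A.X ≫ (α_ _ _ _).hom ≫ A.X ◁ (μ[A.X] ≫ b)) :
    IsCStarFrobenius (transport A w) := by
  apply isCStarFrobenius_of_right
  change ((w.inv ⊗ₘ w.inv) ≫ μ[A.X] ≫ w.hom) ≫ dag ((w.inv ⊗ₘ w.inv) ≫ μ[A.X] ≫ w.hom) =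
    dag ((w.inv ⊗ₘ w.inv) ≫ μ[A.X] ≫ w.hom) ▷ A.X ≫ (α_ _ _ _).hom ≫
      A.X ◁ ((w.inv ⊗ₘ w.inv) ≫ μ[A.X] ≫ w.hom)
  have hd : dag w.hom ≫ dag w.inv = 𝟙 _ := by rw [← dag_comp, w.inv_hom_id, dag_id]
  have hd' : dag w.inv ≫ dag w.hom = 𝟙 _ := by rw [← dag_comp, w.hom_inv_id, dag_id]
  have hb' : b' = dag w.inv ≫ w.inv := by
    calc b' = (dag w.inv ≫ w.inv) ≫ b ≫ b' := by
          rw [hw]; simp only [Category.assoc, Iso.inv_hom_id_assoc]; rw [reassoc_of% hd']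
      _ = _ := by rw [h1, Category.comp_id]
  have e1 : w.inv ≫ b = dag w.hom := by rw [hw, Iso.inv_hom_id_assoc]
  have e2 : b ≫ dag w.inv = w.hom := by rw [hw, Category.assoc, hd, Category.comp_id]
  have lhs : ((w.inv ⊗ₘ w.inv) ≫ μ[A.X] ≫ w.hom) ≫ dag ((w.inv ⊗ₘ w.inv) ≫ μ[A.X] ≫ w.hom) =
      (w.inv ⊗ₘ w.inv) ≫ (μ[A.X] ≫ b ≫ dag μ[A.X]) ≫ (dag w.inv ⊗ₘ dag w.inv) := by
    rw [hw]; simp [dag_comp, dag_tensorHom]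
  rw [lhs, h]
  simp only [dag_comp, dag_tensorHom, Category.assoc]
  have l2 : (w.inv ⊗ₘ w.inv) ≫ (b ≫ dag μ[A.X] ≫ A.X ◁ b') ▷ A.X =
      (dag w.hom ≫ dag μ[A.X]) ▷ A.X ≫ ((𝟙 A.X ⊗ₘ b') ⊗ₘ w.inv) := by
    rw [tensorHom_comp_whiskerRight, ← Category.assoc w.inv, e1, whiskerRight_comp_tensorHom]
    simp
  have l3 : A.X ◁ (μ[A.X] ≫ b) ≫ (dag w.inv ⊗ₘ dag w.inv) = (dag w.inv ⊗ₘ (μ[A.X] ≫ w.hom)) := by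
    rw [whiskerLeft_comp_tensorHom, Category.assoc, e2]
  rw [reassoc_of% l2, l3, associator_naturality_assoc, comp_whiskerRight_assoc]
  simp only [comp_whiskerRight, Category.assoc]
  congr 2
  rw [hb']
  rw [← tensorHom_id (dag w.inv ⊗ₘ dag w.inv), associator_naturality_assoc, tensorHom_comp_tensorHom,
    tensorHom_comp_whiskerLeft, tensorHom_comp_tensorHom_assoc, Category.id_comp, Category.id_comp]

/-- Every rigid haploid algebra is equivalent to a normalized haploid Q-system. -/
theorem exists_equivalent_qSystem (hC : SimpleUnit C) (hA : IsHaploid A) (hr : IsRigid A) :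
    ∃ B : Mon C, IsQSystem B ∧ IsHaploid B ∧ IsNormalized B ∧ Equivalent B A := by
  obtain ⟨b, b', hb, h1, h2, h⟩ := exists_twisted_frobenius hC hA hr
  have h0 : η[A.X] ≠ 0 := by
    obtain ⟨e, he, -⟩ := hr
    exact fun h => id_unit_ne_zero hC (by rw [← he, h, Limits.zero_comp])
  have hfin : Module.Finite ℂ (A.X ⟶ A.X) := by
    obtain ⟨e, he, p, hp⟩ := hr
    exact finite_end_of_exactPairing A.X A.X hC
  obtain ⟨s, hs⟩ := hb
  obtain ⟨r, hr0, hre⟩ := unitScalar_pos hC (isPos_comp_dag (η[A.X] ≫ s))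
  have hη : (η[A.X] ≫ s) ≫ dag (η[A.X] ≫ s) = (r : ℂ) • 𝟙 (𝟙_ C) := by
    rw [unitScalar_spec hC ((η[A.X] ≫ s) ≫ dag (η[A.X] ≫ s)), hre]
  have hbiso : IsIso (s ≫ dag s) := hs ▸ ⟨b', h1, h2⟩
  have hsiso : IsIso s := by
    have : IsIso (dag s) := isIso_of_comp_right_cancel _ fun x hx => by
      rw [← cancel_epi (s ≫ dag s), Category.assoc, hx]; simp
    exact IsIso.of_isIso_comp_right s (dag s)
  have hrne : r ≠ 0 := by
    rintro rfl
    rw [Complex.ofReal_zero, zero_smul] at hη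
    apply h0
    rw [← cancel_mono s, eq_zero_of_comp_dag hη, Limits.zero_comp]
  have hrpos : 0 < r := lt_of_le_of_ne hr0 hrne.symm
  -- With `k` the inverse square root of `r`, the unit `η ≫ k • s` is isometric. Scaling `b` and
  -- `b'` inversely preserves the twisted relation, both sides having degree one in `b`.
  obtain ⟨k, hkc, hkk⟩ : ∃ k : ℂ, conj k = k ∧ k * k * r = 1 := by
    refine ⟨((Real.sqrt r)⁻¹ : ℝ), Complex.conj_ofReal _, ?_⟩
    rw [← Complex.ofReal_mul, ← Complex.ofReal_mul, ← mul_inv, Real.mul_self_sqrt hr0,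
      inv_mul_cancel₀ hrne, Complex.ofReal_one]
  have hkne : k ≠ 0 := by rintro rfl; simp at hkk
  let w : A.X ≅ A.X :=
    { hom := k • s
      inv := k⁻¹ • inv s
      hom_inv_id := by simp [smul_smul, hkne]
      inv_hom_id := by simp [smul_smul, hkne] }
  have hw : (k * k) • b = w.hom ≫ dag w.hom := by
    change _ = (k • s) ≫ dag (k • s)
    rw [dag_smul, hkc, hs]; simp [smul_smul]
  have hF : IsCStarFrobenius (transport A w) := by
    refine isCStarFrobenius_transport (b' := (k * k)⁻¹ • b') w hw ?_ ?_
    · rw [Linear.smul_comp, Linear.comp_smul, smul_smul, h1,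
        mul_inv_cancel₀ (mul_ne_zero hkne hkne), one_smul]
    · simp only [Linear.smul_comp, Linear.comp_smul, MonoidalLinear.whiskerLeft_smul,
        MonoidalLinear.smul_whiskerRight, smul_smul]
      rw [h, inv_mul_cancel₀ (mul_ne_zero hkne hkne), mul_one]
  have hN : IsNormalized (transport A w) := by
    change (η[A.X] ≫ (k • s)) ≫ dag (η[A.X] ≫ (k • s)) = 𝟙 _
    rw [Linear.comp_smul, dag_smul, hkc, Linear.smul_comp, Linear.comp_smul, hη, smul_smul,
      smul_smul, hkk, one_smul]
  have hH : IsHaploid (transport A w) := hA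
  have hη0 := hN.unit_ne_zero hC
  refine ⟨transport A w, ⟨?_, ?_, hF⟩, hH, hN, w.symm, (isEquivalence_transport w).symm⟩
  · exact (SplitMono.mk (dag η[(transport A w).X]) hN).mono
  · obtain ⟨c, hc⟩ := hF.exists_scalar_left hH hη0 (𝟙 _)
    exact ⟨c, by simpa using hc⟩

end Existence

end CStarTensorCategory

/-! ### The main theorem. -/

theorem mainTheorem2 {C : Type u} [Category.{v} C] [Preadditive C] [Linear ℂ C]
    [MonoidalCategory C] [MonoidalPreadditive C] [MonoidalLinear ℂ C] [CStarTensorCategory C]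
    (hC : CStarTensorCategory.SimpleUnit C) :
    -- normalized haploid Q-systems are standard
    (∀ A : CStarTensorCategory.NormalizedHaploidQSystem C,
      CStarTensorCategory.IsStandard A.alg) ∧
    -- every equivalence between normalized haploid Q-systems is unitary
    (∀ (A B : CStarTensorCategory.NormalizedHaploidQSystem C) (S : A.alg.X ≅ B.alg.X),
      CStarTensorCategory.IsEquivalence A.alg B.alg S → CStarTensorCategory.IsUnitary S.hom) ∧
    -- sending a normalized haploid Q-system to its underlying algebra (which is rigid) induces
    -- a bijection on classes
    (∃ Φ : CStarTensorCategory.NormalizedHaploidQSystemClass C →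
        CStarTensorCategory.RigidHaploidAlgebraClass C,
      Function.Bijective Φ ∧
      ∀ A : CStarTensorCategory.NormalizedHaploidQSystem C,
        ∃ h : CStarTensorCategory.IsRigid A.alg,
          Φ (Quotient.mk _ A) =
            Quotient.mk _ ⟨A.alg, A.isQSystem.mono_unit, A.haploid, h⟩) := by
  have hunit : ∀ (A B : CStarTensorCategory.NormalizedHaploidQSystem C) (S : A.alg.X ≅ B.alg.X),
      CStarTensorCategory.IsEquivalence A.alg B.alg S → CStarTensorCategory.IsUnitary S.hom :=
    fun A B S hS => hS.isUnitary hC A.isQSystem.frobenius A.normalized B.isQSystem.frobenius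
      B.haploid B.normalized
  have hrigid : ∀ A : CStarTensorCategory.NormalizedHaploidQSystem C,
      CStarTensorCategory.IsRigid A.alg := fun A => A.isQSystem.frobenius.isRigid A.normalized
  refine ⟨fun A => A.isQSystem.frobenius.isStandard hC A.haploid A.normalized, hunit, ?_⟩
  refine ⟨Quotient.map (fun A => ⟨A.alg, A.isQSystem.mono_unit, A.haploid, hrigid A⟩)
    fun A B ⟨S, hS, _⟩ => ⟨S, hS⟩, ⟨?_, ?_⟩, fun A => ⟨hrigid A, rfl⟩⟩
  · intro a b
    refine Quotient.inductionOn₂ a b fun A B hAB => ?_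
    obtain ⟨S, hS⟩ := Quotient.exact hAB
    exact Quotient.sound ⟨S, hS, hunit A B S hS⟩
  · intro a
    refine Quotient.inductionOn a fun A => ?_
    obtain ⟨B, hB, hBh, hBn, hBA⟩ :=
      CStarTensorCategory.exists_equivalent_qSystem hC A.haploid A.rigid
    exact ⟨Quotient.mk _ ⟨B, hB, hBh, hBn⟩, Quotient.sound hBA⟩
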